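/- **Setting.** Let $\mathbb{K}$ be an algebraically closed field of characteristic $0$, let $p\ge 2$ be an integer (not necessarily prime) and let $\lambda\in\mathbb{Z}$. Let $\sigma(f)(x)=f(x^p)$ on $\mathbb{K}(x)$. Call $f\in\mathbb{K}(x)$ *$\lambda$-Mahler summable* if $f=p^\lambda\sigma(g)-g$ for some $g\in\mathbb{K}(x)$. Write $\mathbb{N}=\{1,2,\dots\}$. **Trees.** A *Mahler tree* $\tau$ is an equivalence class in $\mathbb{K}^\times$ for $\alpha\sim\gamma\Leftrightarrow\alpha^{p^r}=\gamma^{p^s}$ for some $r,s\ge 0$. Its *cycle* $\mathcal{C}(\tau)$ is the (finite) set of roots of unity in $\tau$ of order coprime to $p$, and $\tau$ is *torsion* if $e:=|\mathcal{C}(\tau)|\neq 0$ (equivalently, $\tau$ consists of roots of unity). Fix a torsion tree $\tau$. For $\alpha\in\tau$ the *height* $\eta(\alpha)$ is the least $n\ge 0$ with $\alpha^{p^n}\in\mathcal{C}(\tau)$, and $\tau_h=\{\alpha\in\tau:\eta(\alpha)=h\}$. For $f\in\mathbb{K}(x)$ let $c_k(\alpha)$ be the coefficient of $(x-\alpha)^{-k}$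 in the partial fraction decomposition of $f$, and let $f_\tau=\sum_{k\in\mathbb{N}}\sum_{\alpha\in\tau}\frac{c_k(\alpha)}{(x-\alpha)^k}$ be the *$\tau$-component* of $f$. Let $m$ be the largest order and $h$ the largest height of a pole of $f$ in $\tau$ (when there is one). **Mahler coefficients.** For $n\ge 0$ and $1\le k\le s$, let $V^s_{k,n}(\alpha)$ be the coefficient of $(x-\alpha)^{-k}$ in the partial fraction decomposition of $(x^{p^n}-\alpha^{p^n})^{-s}$, and let $\mathbb{V}^s_{k,n}\in\mathbb{Q}$ be the coefficient of $(x-1)^{s-k}$ in the Taylor expansion of $(1+x+\dots+x^{p^n-1})^{-s}$ at $x=1$. **Cycle map and sections.** Let $\mathcal{S}=\bigoplus_{k\in\mathbb{N}}\mathbb{K}$ and $\mathcal{S}^{\mathcal{C}(\tau)}=\bigoplus_{\gamma\in\mathcal{C}(\tau)}\mathcal{S}$. The *cycle map* $\mathcal{D}_{\lambda,\tau}$ is the endomorphism of $\mathcal{S}^{\mathcal{C}(\tau)}$ sending $(d_k(\gamma))$ to $\bigl(-d_k(\gamma)+p^\lambda\sum_{s\ge k}V^s_{k,1}(\gamma)d_s(\gamma^p)\bigr)$.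 The *$0$-section* $\mathcal{I}^{(0)}_{\lambda,\tau}$ sends $\mathbf{c}=(c_k(\gamma))$ to $\mathbf{d}=(d_k(\gamma))$, where $d_k(\gamma)=0$ for all $\gamma$ if $c_s=0$ on $\mathcal{C}(\tau)$ for every $s\ge k$, and otherwise, by downward recursion on $k$, with $$b_k(\gamma):=c_k(\gamma)-p^\lambda\sum_{s\ge k+1}V^s_{k,1}(\gamma)d_s(\gamma^p),$$ $$d_k(\gamma)=\frac{\gamma^k}{p^{(\lambda-k)e}-1}\sum_{j=0}^{e-1}p^{(\lambda-k)j}\gamma^{-kp^j}b_k(\gamma^{p^j})\ \ (k\ne\lambda),\qquad d_\lambda(\gamma)=\frac{\gamma^\lambda}{e}\sum_{j=0}^{e-1}(j+1-e)\gamma^{-\lambda p^j}b_\lambda(\gamma^{p^j})\ \ (\text{if }\lambda\ge 1).$$ For $\lambda\ge 1$ let $\mathbf{w}^{(\lambda)}=(w_k(\gamma))$ with $w_k=0$ for $k>\lambda$, $w_\lambda(\gamma)=\gamma^\lambda$ and, for $k<\lambda$, $$w_k(\gamma)=\frac{p^\lambda\gamma^k}{1-p^{(\lambda-k)e}}\sum_{j=0}^{e-1}\sum_{s=k+1}^{\lambda}p^{(\lambda-k)j}\,\mathbb{V}^s_{k,1}\,\gamma^{-sp^{j+1}}w_s(\gamma^{p^{j+1}}).$$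 For $\omega\in\mathbb{K}$ the *$\omega$-section* is $\mathcal{I}^{(\omega)}_{\lambda,\tau}(\mathbf{c})=\mathcal{I}^{(0)}_{\lambda,\tau}(\mathbf{c})$ if $\lambda\le 0$, and $\mathcal{I}^{(\omega)}_{\lambda,\tau}(\mathbf{c})=\mathcal{I}^{(0)}_{\lambda,\tau}(\mathbf{c})+\omega\mathbf{w}^{(\lambda)}$ if $\lambda\ge 1$. **Residual average.** Suppose $f$ has a pole in $\tau$, and put $\mathbf{c}=(c_k(\gamma))_{k\in\mathbb{N},\gamma\in\mathcal{C}(\tau)}$. If $\lambda\le 0$ or $h=0$, then $\omega_{\lambda,\tau}(f)=0$. If $\lambda,h\ge 1$, then with $\mathbf{d}^{(0)}=\mathcal{I}^{(0)}_{\lambda,\tau}(\mathbf{c})$ and $\tilde{\mathbf{c}}=\mathcal{D}_{\lambda,\tau}(\mathbf{d}^{(0)})$, $$\omega_{\lambda,\tau}(f)=\frac{1}{(p^h-p^{h-1})e}\sum_{\alpha\in\tau_h}\sum_{s\ge\lambda}\sum_{n=0}^{h-1}p^{\lambda n}\mathbb{V}^s_{\lambda,n}\alpha^{-sp^n}c_s(\alpha^{p^n})-\frac{p^{\lambda(h-1)}}{e}\sum_{\gamma\in\mathcal{C}(\tau)}\sum_{s\ge\lambda}\mathbb{V}^s_{\lambda,h-1}\gamma^{-s}\bigl(\tilde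 c_s(\gamma)+d^{(0)}_s(\gamma)\bigr).$$ **Residues.** For $k\in\mathbb{N}$ define the vector $\mathrm{dres}_\lambda(f,\tau,k)\in\bigoplus_{\alpha\in\tau}\mathbb{K}$ as follows. It is $\mathbf{0}$ if $f$ has no pole in $\tau$ or if $k>m$. Otherwise: - if $h=0$, its $\alpha$-entry is $c_k(\alpha)$ for $\alpha\in\mathcal{C}(\tau)$ and $0$ for all other $\alpha$; - if $h\ge 1$, let $\mathbf{d}=\mathcal{I}^{(\omega)}_{\lambda,\tau}(\mathbf{c})$ with $\omega=\omega_{\lambda,\tau}(f)$ and let $\tilde{\mathbf{c}}=\mathcal{D}_{\lambda,\tau}(\mathbf{d})$. For $\eta(\alpha)=h$, $$\mathrm{dres}_\lambda(f,\tau,k)_\alpha=\sum_{s=k}^{m}\sum_{n=0}^{h-1}p^{\lambda n}V^s_{k,n}(\alpha)c_s(\alpha^{p^n})-p^{\lambda(h-1)}\sum_{s=k}^{m}\mathbb{V}^s_{k,h-1}\alpha^{k-sp^{h+e-1}}\Bigl(\tilde c_s\bigl(\alpha^{p^{h+e-1}}\bigr)+d_s\bigl(\alpha^{p^{h+e-1}}\bigr)\Bigr);$$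 if $k=\lambda\ge 1$ and $\gamma\in\mathcal{C}(\tau)$, then $\mathrm{dres}_\lambda(f,\tau,\lambda)_\gamma=c_\lambda(\gamma)-\tilde c_\lambda(\gamma)$; all remaining entries are $0$. **Proposition.** For every $f\in\mathbb{K}(x)$, every $\lambda\in\mathbb{Z}$ and every torsion Mahler tree $\tau$, the component $f_\tau$ is $\lambda$-Mahler summable if and only if $\mathrm{dres}_\lambda(f,\tau,k)=\mathbf{0}$ for every $k\in\mathbb{N}$. -/

import Mathlib

noncomputable section

open scoped Classical
open scoped LaurentSeries

namespace Mahler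

/-! ### The Mahler operator and summability -/

/-- The Mahler operator `σ : f(x) ↦ f(x ^ p)` on `K(x)`. -/
def mahlerOp {K : Type*} [Field K] (p : ℕ) (f : RatFunc K) : RatFunc K :=
  RatFunc.eval (algebraMap K (RatFunc K)) (RatFunc.X ^ p) f

/-- `f` is `lam`-Mahler summable: `f = p ^ lam * g(x ^ p) - g(x)` for some `g ∈ K(x)`. -/
def IsMahlerSummable {K : Type*} [Field K] (p : ℕ) (lam : ℤ) (f : RatFunc K) : Prop :=
  ∃ g : RatFunc K, f = ((p : K) ^ lam) • mahlerOp p g - g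

/-! ### Partial fractions and poles -/

/-- For `k ≥ 1`, the coefficient of `1 / (x - α) ^ k` in the partial fraction decomposition of `f`,
i.e. the coefficient of `(x - α) ^ (-k)` in the Laurent expansion of `f` at `α`. -/
def pfCoeff {K : Type*} [Field K] (f : RatFunc K) (α : K) (k : ℕ) : K :=
  ((RatFunc.laurent α f : RatFunc K) : LaurentSeries K).coeff (-(k : ℤ))

/-- The order of `α` as a pole of `f` (it is `0` when `α` is not a pole). -/
def poleOrder {K : Type*} [Field K] (f : RatFunc K) (α : K) : ℕ :=
  f.denom.rootMultiplicity α

/-! ### Mahler coefficients -/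

/-- The Mahler coefficient `V^m_{k,n}(α)`: the coefficient of `1 / (x - α) ^ k` in the partial
fraction decomposition of `1 / (x ^ (p ^ n) - α ^ (p ^ n)) ^ m`. -/
def mahlerCoeff {K : Type*} [Field K] (p m k n : ℕ) (α : K) : K :=
  pfCoeff (1 / (RatFunc.X ^ (p ^ n) - RatFunc.C (α ^ (p ^ n))) ^ m : RatFunc K) α k

/-- The universal Mahler coefficient `𝕍^m_{k,n} ∈ ℚ` (for `k ≤ m`): the coefficient of
`(x - 1) ^ (m - k)` in the Taylor expansion at `x = 1` of `(x ^ (p ^ n - 1) + ⋯ + x + 1) ^ (-m)`;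
here the power series variable stands for `x - 1`. -/
def univCoeff (p m k n : ℕ) : ℚ :=
  PowerSeries.coeff (m - k)
    (((∑ i ∈ Finset.range (p ^ n), (1 + PowerSeries.X : PowerSeries ℚ) ^ i)⁻¹) ^ m)

/-! ### Mahler trees and their cycles -/

/-- A Mahler tree: an equivalence class in `K \ {0}` for the relation
`α ∼ γ ↔ ∃ r s ≥ 0, α ^ (p ^ r) = γ ^ (p ^ s)`. -/
structure MahlerTree (K : Type*) [Field K] (p : ℕ) where
  carrier : Set K
  isClass : ∃ α : K, α ≠ 0 ∧
    carrier = {γ : K | γ ≠ 0 ∧ ∃ r s : ℕ, α ^ (p ^ r) = γ ^ (p ^ s)}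

namespace MahlerTree

variable {K : Type*} [Field K] {p : ℕ}

/-- The Mahler cycle `C(τ)`: the roots of unity in `τ` of order coprime to `p`. -/
def cycle (τ : MahlerTree K p) : Set K :=
  {γ : K | γ ∈ τ.carrier ∧ IsOfFinOrder γ ∧ (orderOf γ).Coprime p}

/-- The cycle length `ε(τ) = |C(τ)|` (`C(τ)` is finite, see `finite_cycle`). -/
def cycleLength (τ : MahlerTree K p) : ℕ := τ.cycle.ncard

/-- Torsion Mahler trees: those of non-zero cycle length. -/
def IsTorsion (τ : MahlerTree K p) : Prop := τ.cycleLength ≠ 0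

theorem pow_mem_cycle (τ : MahlerTree K p) {γ : K} (hγ : γ ∈ τ.cycle) (n : ℕ) :
    γ ^ (p ^ n) ∈ τ.cycle := by
  obtain ⟨hmem, hfin, hcop⟩ := hγ
  obtain ⟨α, hα, hc⟩ := τ.isClass
  rw [hc] at hmem
  obtain ⟨h0, r, s, hrs⟩ := hmem
  refine ⟨?_, hfin.pow, ?_⟩
  · rw [hc]
    refine ⟨pow_ne_zero _ h0, r + n, s, ?_⟩
    rw [pow_add, pow_mul, hrs, ← pow_mul, ← pow_mul, mul_comm]
  · rw [(hcop.pow_right n).orderOf_pow]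
    exact hcop

theorem finite_cycle (τ : MahlerTree K p) : τ.cycle.Finite := by
  rcases τ.cycle.eq_empty_or_nonempty with h | ⟨γ₀, hγ₀⟩
  · rw [h]; exact Set.finite_empty
  have hpos : 0 < orderOf γ₀ := hγ₀.2.1.orderOf_pos
  refine Set.Finite.subset (Polynomial.nthRootsFinset (orderOf γ₀) (1 : K)).finite_toSet ?_
  intro γ hγ
  obtain ⟨α, hα, hc⟩ := τ.isClass
  have h1 := hγ.1
  have h2 := hγ₀.1
  rw [hc] at h1 h2
  obtain ⟨-, r, s, hrs⟩ := h1
  obtain ⟨-, r', s', hrs'⟩ := h2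
  have key : γ ^ (p ^ (s + r')) = γ₀ ^ (p ^ (s' + r)) := by
    rw [pow_add, pow_mul, ← hrs, pow_add, pow_mul, ← hrs', ← pow_mul, ← pow_mul, mul_comm]
  have ho : orderOf γ = orderOf γ₀ := by
    have := congrArg orderOf key
    rwa [(hγ.2.2.pow_right _).orderOf_pow, (hγ₀.2.2.pow_right _).orderOf_pow] at this
  have : γ ^ orderOf γ₀ = 1 := by rw [← ho]; exact pow_orderOf_eq_one γ
  simpa [Polynomial.mem_nthRootsFinset hpos] using this

instance instFiniteCycle (τ : MahlerTree K p) : Finite τ.cycle := τ.finite_cycle.to_subtype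

instance instFintypeCycle (τ : MahlerTree K p) : Fintype τ.cycle := Fintype.ofFinite _

/-- The map `γ ↦ γ ^ (p ^ n)` on the Mahler cycle. -/
def cyclePow (τ : MahlerTree K p) (n : ℕ) (γ : τ.cycle) : τ.cycle :=
  ⟨(γ : K) ^ (p ^ n), τ.pow_mem_cycle γ.2 n⟩

/-! ### The cycle map and its sections -/

/-- The space `S^{C(τ)}`, where `S` is the space of finitely supported sequences indexed by the
positive integers; the entry `d_k(γ)` is `d γ k`. -/
abbrev CycleSpace (τ : MahlerTree K p) : Type _ := τ.cycle → ℕ+ →₀ K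

/-- The entry `d_k(β)`, extended by zero to `β ∉ C(τ)` (and to `k = 0`). -/
def CycleSpace.entry {τ : MahlerTree K p} (d : τ.CycleSpace) (k : ℕ) (β : K) : K :=
  if h : β ∈ τ.cycle ∧ 0 < k then d ⟨β, h.1⟩ ⟨k, h.2⟩ else 0

/-- The linear map `S → S` sending `(a_s)_s` to `(∑_{s ≥ k} V^s_{k,1}(γ) a_s)_k`. -/
def shiftMap (p : ℕ) (γ : K) : (ℕ+ →₀ K) →ₗ[K] (ℕ+ →₀ K) :=
  Finsupp.linearCombination K fun s : ℕ+ =>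
    ∑ k ∈ Finset.Icc 1 s, Finsupp.single k (mahlerCoeff p s k 1 γ)

/-- The cycle map `D_{lam,τ}`, see `cycleMap_apply` for the formula. -/
def cycleMap (τ : MahlerTree K p) (lam : ℤ) : τ.CycleSpace →ₗ[K] τ.CycleSpace :=
  LinearMap.pi fun γ =>
    -LinearMap.proj γ +
      ((p : K) ^ lam) • (shiftMap p (γ : K) ∘ₗ LinearMap.proj (τ.cyclePow 1 γ))

theorem cycleMap_apply (τ : MahlerTree K p) (lam : ℤ) (d : τ.CycleSpace) (γ : τ.cycle) (k : ℕ+) :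
    τ.cycleMap lam d γ k =
      -d γ k + (p : K) ^ lam *
        ∑ s ∈ (d (τ.cyclePow 1 γ)).support with k ≤ s,
          mahlerCoeff p s k 1 (γ : K) * d (τ.cyclePow 1 γ) s := by
  simp only [cycleMap, shiftMap, LinearMap.pi_apply, LinearMap.add_apply, LinearMap.neg_apply,
    LinearMap.proj_apply, LinearMap.smul_apply, LinearMap.comp_apply, Finsupp.coe_add,
    Finsupp.coe_neg, Finsupp.coe_smul, Pi.add_apply, Pi.neg_apply, Pi.smul_apply, smul_eq_mul,
    Finsupp.linearCombination_apply, Finsupp.sum, Finsupp.finsetSum_apply, Finset.sum_filter]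
  congr 2
  refine Finset.sum_congr rfl fun s _ => ?_
  by_cases h : k ≤ s
  · rw [if_pos h, Finset.sum_eq_single k]
    · rw [Finsupp.single_eq_same, mul_comm]
    · intro b _ hb
      exact Finsupp.single_eq_of_ne hb.symm
    · intro hk
      exact absurd (Finset.mem_Icc.2 ⟨one_le, h⟩) hk
  · rw [if_neg h, Finset.sum_eq_zero, mul_zero]
    intro b hb
    refine Finsupp.single_eq_of_ne ?_
    rintro rfl
    exact h (Finset.mem_Icc.1 hb).2

/-- The largest degree `k` with some `c_k(γ) ≠ 0` (and `1` if `c = 0`). -/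
def topDegree {τ : MahlerTree K p} (c : τ.CycleSpace) : ℕ+ :=
  Finset.univ.sup fun γ => (c γ).support.sup id

/-- The entries `d_k(γ)` of the `0`-section of `c`, by downward recursion on `k`: they vanish when
`k` exceeds the degree of `c`, i.e. when `c_s = 0` for all `s ≥ k`, and otherwise are computed from
the `d_s` with `s > k`. -/
def zeroSectionCoeff (τ : MahlerTree K p) (lam : ℤ) (c : τ.CycleSpace) (k : ℕ+) (γ : τ.cycle) : K :=
  if topDegree c < k then 0
  else
    let e : ℕ := τ.cycleLength
    let b : τ.cycle → K := fun δ =>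
      c δ k - (p : K) ^ lam *
        ∑ s ∈ (Finset.Ioc k (topDegree c)).attach,
          mahlerCoeff p s.1 k 1 (δ : K) * zeroSectionCoeff τ lam c s.1 (τ.cyclePow 1 δ)
    if (k : ℤ) = lam then
      (γ : K) ^ (k : ℕ) / (e : K) *
        ∑ j ∈ Finset.range e,
          ((j : K) + 1 - (e : K)) * ((γ : K) ^ ((k : ℕ) * p ^ j))⁻¹ * b (τ.cyclePow j γ)
    else
      (γ : K) ^ (k : ℕ) / ((p : K) ^ ((lam - k) * e) - 1) *
        ∑ j ∈ Finset.range e,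
          (p : K) ^ ((lam - k) * j) * ((γ : K) ^ ((k : ℕ) * p ^ j))⁻¹ * b (τ.cyclePow j γ)
termination_by (topDegree c : ℕ) + 1 - (k : ℕ)
decreasing_by
  have h := Finset.mem_Ioc.1 s.2
  have h1 : (k : ℕ) < (s.1 : ℕ) := h.1
  have h2 : (s.1 : ℕ) ≤ (topDegree c : ℕ) := h.2
  omega

/-- The `0`-section `I^{(0)}_{lam,τ}` of the cycle map. -/
def zeroSection (τ : MahlerTree K p) (lam : ℤ) (c : τ.CycleSpace) : τ.CycleSpace := fun γ =>
  Finsupp.onFinset (Finset.Icc 1 (topDegree c)) (fun k => τ.zeroSectionCoeff lam c k γ) (by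
    intro k hk
    refine Finset.mem_Icc.2 ⟨one_le, ?_⟩
    by_contra h
    apply hk
    rw [zeroSectionCoeff, if_pos (not_le.1 h)])

/-- The entries `w_k(γ)` of the kernel vector `w^{(ℓ)}`, `ℓ ≥ 1`, by downward recursion on `k`. -/
def kernelCoeff (τ : MahlerTree K p) (l : ℕ+) (k : ℕ+) (γ : τ.cycle) : K :=
  if l < k then 0
  else if k = l then (γ : K) ^ (l : ℕ)
  else
    let e : ℕ := τ.cycleLength
    (p : K) ^ (l : ℕ) * (γ : K) ^ (k : ℕ) / (1 - (p : K) ^ (((l : ℤ) - k) * e)) *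
      ∑ j ∈ Finset.range e, ∑ s ∈ (Finset.Ioc k l).attach,
        (p : K) ^ (((l : ℤ) - k) * j) * (univCoeff p s.1 k 1 : K) *
          ((γ : K) ^ ((s.1 : ℕ) * p ^ (j + 1)))⁻¹ * kernelCoeff τ l s.1 (τ.cyclePow (j + 1) γ)
termination_by (l : ℕ) + 1 - (k : ℕ)
decreasing_by
  have h := Finset.mem_Ioc.1 s.2
  have h1 : (k : ℕ) < (s.1 : ℕ) := h.1
  have h2 : (s.1 : ℕ) ≤ (l : ℕ) := h.2
  omega

/-- The vector `w^{(ℓ)}`, spanning the kernel of the cycle map for `lam = ℓ ≥ 1`. -/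
def kernelVec (τ : MahlerTree K p) (l : ℕ+) : τ.CycleSpace := fun γ =>
  Finsupp.onFinset (Finset.Icc 1 l) (fun k => τ.kernelCoeff l k γ) (by
    intro k hk
    refine Finset.mem_Icc.2 ⟨one_le, ?_⟩
    by_contra h
    apply hk
    rw [kernelCoeff, if_pos (not_le.1 h)])

/-- The `ω`-section `I^{(ω)}_{lam,τ}` of the cycle map. -/
def omegaSection (τ : MahlerTree K p) (lam : ℤ) (ω : K) (c : τ.CycleSpace) : τ.CycleSpace :=
  if h : 0 < lam then
    τ.zeroSection lam c + ω • τ.kernelVec ⟨lam.toNat, Int.lt_toNat.2 (by simpa using h)⟩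
  else τ.zeroSection lam c

/-! ### The component of a rational function at a tree -/

/-- The singular support `sing(f,τ)`: the poles of `f` in `τ`. -/
def sing (τ : MahlerTree K p) (f : RatFunc K) : Finset K :=
  f.denom.roots.toFinset.filter fun α => α ∈ τ.carrier

/-- `ord(f,τ)`: the largest order of a pole of `f` in `τ` (`0` if there is none). -/
def ord (τ : MahlerTree K p) (f : RatFunc K) : ℕ := (τ.sing f).sup (poleOrder f)

/-- The `τ`-component `f_τ`: the part of the partial fraction decomposition of `f` with poles in
`τ`. -/
def component (τ : MahlerTree K p) (f : RatFunc K) : RatFunc K :=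
  ∑ α ∈ τ.sing f, ∑ k ∈ Finset.Icc 1 (poleOrder f α),
    RatFunc.C (pfCoeff f α k) / (RatFunc.X - RatFunc.C α) ^ k

/-- The height `η(α)`: the smallest `n` with `α ^ (p ^ n) ∈ C(τ)` (for a torsion tree `τ` and
`α ∈ τ` such an `n` exists). -/
def height (τ : MahlerTree K p) (α : K) : ℕ := sInf {n : ℕ | α ^ (p ^ n) ∈ τ.cycle}

/-- `ht(f,τ)`: the largest height of a pole of `f` in `τ`. -/
def ht (τ : MahlerTree K p) (f : RatFunc K) : ℕ := (τ.sing f).sup τ.height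

/-- The (finite) set `τ_h` of elements of `τ` of height `h`. -/
def level (τ : MahlerTree K p) (h : ℕ) : Set K := {α : K | α ∈ τ.carrier ∧ τ.height α = h}

/-- The vector `(c_k(γ))_{k ≥ 1, γ ∈ C(τ)}` of partial fraction coefficients of `f` at the points
of the cycle. -/
def cycleCoeffs (τ : MahlerTree K p) (f : RatFunc K) : τ.CycleSpace := fun γ =>
  Finsupp.onFinset
    (Finset.Icc 1 (Nat.toPNat'
      (-((RatFunc.laurent (γ : K) f : RatFunc K) : LaurentSeries K).order).toNat))
    (fun k => pfCoeff f (γ : K) k) (by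
      intro k hk
      refine Finset.mem_Icc.2 ⟨one_le, ?_⟩
      have h : ((RatFunc.laurent (γ : K) f : RatFunc K) : LaurentSeries K).order
          ≤ -((k : ℕ) : ℤ) := HahnSeries.order_le_of_coeff_ne_zero hk
      have hk0 := k.pos
      rw [← PNat.coe_le_coe, Nat.toPNat'_coe, if_pos (by omega)]
      omega)

/-! ### Residual average and residues -/

/-- The residual average `ω_{lam,τ}(f)`. All the coefficients `c_s`, `d_s`, `c̃_s` with
`s > ord(f,τ)` vanish, so the sums over `s ≥ lam` stop at `ord(f,τ)`. -/
def residualAverage (τ : MahlerTree K p) (lam : ℤ) (f : RatFunc K) : K :=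
  let h : ℕ := τ.ht f
  let m : ℕ := τ.ord f
  let e : ℕ := τ.cycleLength
  let l : ℕ := lam.toNat
  let d : τ.CycleSpace := τ.zeroSection lam (τ.cycleCoeffs f)
  let c' : τ.CycleSpace := τ.cycleMap lam d
  if lam ≤ 0 ∨ h = 0 then 0
  else
    1 / (((p : K) ^ h - (p : K) ^ (h - 1)) * (e : K)) *
        (∑ᶠ α ∈ τ.level h, ∑ s ∈ Finset.Icc l m, ∑ n ∈ Finset.range h,
          (p : K) ^ (l * n) * (univCoeff p s l n : K) * (α ^ (s * p ^ n))⁻¹ *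
            pfCoeff f (α ^ (p ^ n)) s)
      - (p : K) ^ (l * (h - 1)) / (e : K) *
        ∑ γ : τ.cycle, ∑ s ∈ Finset.Icc l m,
          (univCoeff p s l (h - 1) : K) * ((γ : K) ^ s)⁻¹ *
            (c'.entry s (γ : K) + d.entry s (γ : K))

/-- For a torsion tree `τ` and `k ≥ 1`, the `lam`-Mahler discrete residue `dres_lam(f,τ,k)`,
a vector indexed by the elements of `τ`. -/
def dres (τ : MahlerTree K p) (lam : ℤ) (f : RatFunc K) (k : ℕ) : τ.carrier → K := fun α =>
  let h : ℕ := τ.ht f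
  let m : ℕ := τ.ord f
  let e : ℕ := τ.cycleLength
  let c : τ.CycleSpace := τ.cycleCoeffs f
  let d : τ.CycleSpace := τ.omegaSection lam (τ.residualAverage lam f) c
  let c' : τ.CycleSpace := τ.cycleMap lam d
  if τ.sing f = ∅ ∨ m < k then 0
  else if h = 0 then
    if (α : K) ∈ τ.cycle then pfCoeff f (α : K) k else 0
  else if τ.height (α : K) = h then
    (∑ s ∈ Finset.Icc k m, ∑ n ∈ Finset.range h,
        (p : K) ^ (lam * n) * mahlerCoeff p s k n (α : K) * pfCoeff f ((α : K) ^ (p ^ n)) s)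
      - (p : K) ^ (lam * ((h : ℤ) - 1)) *
        ∑ s ∈ Finset.Icc k m,
          (univCoeff p s k (h - 1) : K) *
            (α : K) ^ ((k : ℤ) - (s : ℤ) * (p : ℤ) ^ (h + e - 1)) *
            (c'.entry s ((α : K) ^ (p ^ (h + e - 1))) + d.entry s ((α : K) ^ (p ^ (h + e - 1))))
  else if (k : ℤ) = lam ∧ (α : K) ∈ τ.cycle then
    c.entry k (α : K) - c'.entry k (α : K)
  else 0

end MahlerTree

end Mahler

end

/-! Write `P = p ^ lam`, let `delta g = P • σ g - g`, and let `h` be the largest height of a pole of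
`f` in `τ`. The proof reduces summability to finite linear data on the cycle plus one condition at
height `h`.

Suppose that `f_τ = delta g`. Every element of `τ` has a `p`-th root one level higher, and `σ`
creates no cancellation of poles away from `0`, so the poles of `g` in `τ` have height below `h`
(`IsTorsion.pfCoeff_eq_zero_of_delta`). The principal parts `d` of `g` on the cycle are mapped by
the cycle map to those of `f`. Moreover `∑ n < h, P ^ n • σ ^ n (delta g)` telescopes to `P ^ h • σ
^ h g - g`. At a point `α` of height `h` the term `g` is regular, and the principal part of `σ ^ h
g` depends only on `d`, because `α ^ p ^ h` lies on the cycle. This gives the vanishing of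
`obstruction` (`IsTorsion.exists_of_summable`).

Conversely, given such a `d`, put `H = P ^ h • σ ^ h (cycleFun d) - ∑ n < h, P ^ n • σ ^ n f`. Then
`delta H` has the principal parts of `f` at all heights `≤ h`, and the vanishing obstruction allows
`H` to be truncated to heights `< h`. The truncation sums `f_τ`: both sides vanish at infinity and
have equal principal parts (`IsTorsion.summable_of_exists`).

It remains to find `d`. The cycle map is triangular in the degree `k`; after normalization by `γ ^
k` its diagonal part is `D ↦ q D(γ ^ p) - D(γ)` with `q = p ^ (lam - k)`. This is invertible for `k
≠ lam`, while for `k = lam` its kernel is the constants and its image the functions of sum zero.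
Hence the preimages of `c`, if any, are the sections `I^(ω)(c)` (`eq_omegaSection_of_cycleMap_eq`),
and averaging the degree `lam` obstruction over the level `h` forces `ω` to be the residual average
(`IsTorsion.eq_residualAverage`). For this `ω` the residues at height `h` are the obstructions, and
those on the cycle measure the failure of `c` to lie in the image. -/

noncomputable section

open scoped Classical
open scoped LaurentSeries RatFunc

namespace Mahler

/-! ### Laurent expansions and partial fraction coefficients -/

section

variable {K : Type*} [Field K]

/-- The Laurent expansion at `α`, as a ring homomorphism. -/
def locExp (α : K) : RatFunc K →+* LaurentSeries K :=
  (algebraMap (RatFunc K) (LaurentSeries K)).comp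
    (RatFunc.laurent α : RatFunc K →ₐ[K] RatFunc K).toRingHom

theorem pfCoeff_eq_locExp (f : RatFunc K) (α : K) (k : ℕ) :
    pfCoeff f α k = (locExp α f).coeff (-(k : ℤ)) := rfl

theorem locExp_algebraMap (α : K) (a : Polynomial K) :
    locExp α (algebraMap _ _ a) = ((Polynomial.taylor α a : PowerSeries K) : LaurentSeries K) := by
  simp only [locExp, RingHom.comp_apply, AlgHom.toRingHom_eq_coe, RingHom.coe_coe,
    RatFunc.laurent_algebraMap]
  rw [RatFunc.coe_coe]
  rfl

theorem locExp_C (α c : K) : locExp α (RatFunc.C c) = HahnSeries.C c := by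
  rw [← RatFunc.algebraMap_C, locExp_algebraMap, Polynomial.taylor_C, Polynomial.coe_C,
    PowerSeries.coe_C]

/-- `pfCoeff` as a linear map. -/
def pfLin (α : K) (k : ℕ) : RatFunc K →ₗ[K] K where
  toFun f := pfCoeff f α k
  map_add' f g := by simp [pfCoeff_eq_locExp]
  map_smul' c f := by
    simp [pfCoeff_eq_locExp, RatFunc.smul_eq_C_mul, locExp_C]

theorem pfLin_apply (α : K) (k : ℕ) (f : RatFunc K) : pfLin α k f = pfCoeff f α k := rfl

/-- Multiplying by the `s`-th power of the local parameter clears the pole, so polar coefficients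
become power series coefficients shifted by `s`. -/
theorem pfCoeff_of_mul_pow {f : RatFunc K} {α : K} {s : ℕ} {u : PowerSeries K}
    (h : locExp α f * HahnSeries.single (s : ℤ) 1 = (u : LaurentSeries K)) (k : ℕ) :
    pfCoeff f α k = if k ≤ s then PowerSeries.coeff (s - k) u else 0 := by
  have h1 : (locExp α f * HahnSeries.single (s : ℤ) 1).coeff (-(k : ℤ) + s) =
      (locExp α f).coeff (-(k : ℤ)) := by
    rw [HahnSeries.coeff_mul_single_add, mul_one]
  rw [pfCoeff_eq_locExp, ← h1, h, PowerSeries.coeff_coe]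
  split_ifs with h2 h3 h3
  · omega
  · rfl
  · congr 2; omega
  · omega

theorem coe_inv_powerSeries {u : PowerSeries K} (hu : PowerSeries.constantCoeff u ≠ 0) :
    ((u⁻¹ : PowerSeries K) : LaurentSeries K) = (u : LaurentSeries K)⁻¹ := by
  refine eq_inv_of_mul_eq_one_left ?_
  rw [← PowerSeries.coe_mul, PowerSeries.inv_mul_cancel _ hu, PowerSeries.coe_one]

theorem constantCoeff_taylor (α : K) (b : Polynomial K) :
    PowerSeries.constantCoeff (Polynomial.taylor α b : PowerSeries K) = b.eval α := by
  rw [Polynomial.constantCoeff_coe, Polynomial.taylor_coeff_zero]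

theorem locExp_X_sub_C (α : K) :
    locExp α (RatFunc.X - RatFunc.C α) = HahnSeries.single (1 : ℤ) 1 := by
  rw [map_sub, locExp_C, ← RatFunc.algebraMap_X, locExp_algebraMap]
  simp [PowerSeries.coe_add]

theorem pfCoeff_div (a b : Polynomial K) (α : K) (hb : b.eval α ≠ 0) (s k : ℕ) :
    pfCoeff (algebraMap _ _ a / (algebraMap _ _ b * (RatFunc.X - RatFunc.C α) ^ s)) α k =
      if k ≤ s then PowerSeries.coeff (s - k)
        ((Polynomial.taylor α a : PowerSeries K) * (Polynomial.taylor α b : PowerSeries K)⁻¹)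
      else 0 := by
  have hb' : PowerSeries.constantCoeff (Polynomial.taylor α b : PowerSeries K) ≠ 0 := by
    rwa [constantCoeff_taylor]
  refine pfCoeff_of_mul_pow ?_ k
  rw [map_div₀, map_mul, map_pow, locExp_algebraMap, locExp_algebraMap, locExp_X_sub_C,
    PowerSeries.coe_mul, coe_inv_powerSeries hb', RatFunc.single_one_eq_pow]
  have : (HahnSeries.single (1 : ℤ) (1 : K) : LaurentSeries K) ≠ 0 := by simp
  have h2 : ((Polynomial.taylor α b : PowerSeries K) : LaurentSeries K) ≠ 0 := by
    intro h0
    apply hb'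
    rw [← PowerSeries.coe_zero] at h0
    rw [HahnSeries.ofPowerSeries_injective h0, map_zero]
  field_simp

/-- `f` has no pole at `α`. -/
def RegularAt (f : RatFunc K) (α : K) : Prop := f.denom.eval α ≠ 0

theorem regularAt_of_eq_div {f : RatFunc K} {α : K} {a b : Polynomial K}
    (hb : b.eval α ≠ 0) (h : f = algebraMap _ _ a / algebraMap _ _ b) : RegularAt f α := by
  intro h0
  apply hb
  have hd : f.denom ∣ b := by rw [h]; exact RatFunc.denom_div_dvd a b
  obtain ⟨c, rfl⟩ := hd
  rw [Polynomial.eval_mul, h0, zero_mul]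

theorem pfCoeff_eq_zero_of_regularAt {f : RatFunc K} {α : K} (h : RegularAt f α) {k : ℕ}
    (hk : 1 ≤ k) : pfCoeff f α k = 0 := by
  have := pfCoeff_div f.num f.denom α h 0 k
  rwa [pow_zero, mul_one, RatFunc.num_div_denom, if_neg (by omega)] at this

theorem denom_factor (f : RatFunc K) (α : K) : ∃ b : Polynomial K, b.eval α ≠ 0 ∧
    f.denom = (Polynomial.X - Polynomial.C α) ^ poleOrder f α * b ∧
    f = algebraMap _ _ f.num /
      (algebraMap _ _ b * (RatFunc.X - RatFunc.C α) ^ poleOrder f α) := by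
  obtain ⟨b, hb, hnd⟩ := Polynomial.exists_eq_pow_rootMultiplicity_mul_and_not_dvd f.denom
    (RatFunc.denom_ne_zero f) α
  refine ⟨b, ?_, hb, ?_⟩
  · intro h0
    exact hnd (Polynomial.dvd_iff_isRoot.2 h0)
  · conv_lhs => rw [← RatFunc.num_div_denom f, hb]
    rw [mul_comm _ b, map_mul, map_pow, map_sub, RatFunc.algebraMap_X, RatFunc.algebraMap_C]
    rfl

theorem pfCoeff_eq_zero_of_lt {f : RatFunc K} {α : K} {k : ℕ} (h : poleOrder f α < k) :
    pfCoeff f α k = 0 := by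
  obtain ⟨b, hb, -, hf⟩ := denom_factor f α
  have := pfCoeff_div f.num b α hb (poleOrder f α) k
  rwa [← hf, if_neg (by omega)] at this

/-- The top coefficient is `num(α) / b(α)`, with `b` the cofactor of the denominator; `num(α) ≠ 0`
because numerator and denominator are coprime. -/
theorem pfCoeff_poleOrder_ne_zero {f : RatFunc K} {α : K} (h : 0 < poleOrder f α) :
    pfCoeff f α (poleOrder f α) ≠ 0 := by
  obtain ⟨b, hb, hd, hf⟩ := denom_factor f α
  have := pfCoeff_div f.num b α hb (poleOrder f α) (poleOrder f α)
  rw [← hf, if_pos le_rfl, Nat.sub_self, PowerSeries.coeff_zero_eq_constantCoeff_apply, map_mul,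
    PowerSeries.constantCoeff_inv, constantCoeff_taylor, constantCoeff_taylor] at this
  rw [this]
  refine mul_ne_zero ?_ (inv_ne_zero hb)
  intro h0
  have hd0 : f.denom.eval α = 0 := by
    rw [hd, Polynomial.eval_mul, Polynomial.eval_pow]
    simp [h.ne']
  obtain ⟨u, v, huv⟩ := RatFunc.isCoprime_num_denom f
  have := congrArg (Polynomial.eval α) huv
  simp [h0, hd0] at this

theorem poleOrder_pos_iff {f : RatFunc K} {α : K} : 0 < poleOrder f α ↔ f.denom.IsRoot α :=
  Polynomial.rootMultiplicity_pos (RatFunc.denom_ne_zero f)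

theorem regularAt_of_pfCoeff_eq_zero {f : RatFunc K} {α : K}
    (h : ∀ k, 1 ≤ k → pfCoeff f α k = 0) : RegularAt f α := by
  intro h0
  have := poleOrder_pos_iff.2 (show f.denom.IsRoot α from h0)
  exact pfCoeff_poleOrder_ne_zero this (h _ this)

theorem pfCoeff_C_div_pow (c α β : K) (j k : ℕ) (hk : 1 ≤ k) :
    pfCoeff (RatFunc.C c / (RatFunc.X - RatFunc.C β) ^ j) α k = if α = β ∧ k = j then c else 0 := by
  by_cases h : α = β
  · subst h
    have := pfCoeff_div (Polynomial.C c) 1 α (by simp) j k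
    rw [map_one, one_mul, RatFunc.algebraMap_C] at this
    rw [this]
    simp only [true_and, Polynomial.taylor_C, Polynomial.taylor_one, Polynomial.coe_C,
      Polynomial.coe_one,
      PowerSeries.coeff_C_mul, Polynomial.C_1]
    rw [show (1 : PowerSeries K)⁻¹ = 1 by
      rw [PowerSeries.inv_eq_iff_mul_eq_one] <;> simp, PowerSeries.coeff_one]
    split_ifs <;> first | omega | simp
  · rw [if_neg (by tauto)]
    refine pfCoeff_eq_zero_of_regularAt ?_ hk
    refine regularAt_of_eq_div (a := Polynomial.C c)
      (b := (Polynomial.X - Polynomial.C β) ^ j) ?_ ?_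
    · simpa using fun h1 => absurd (sub_eq_zero.1 h1) h
    · rw [map_pow, map_sub, RatFunc.algebraMap_X, RatFunc.algebraMap_C, RatFunc.algebraMap_C]

end

/-! ### The substitution `x ↦ x ^ q` as an algebra endomorphism -/

section

variable {K : Type*} [Field K]

/-- The endomorphism `f(x) ↦ f(x ^ q)` of `K(x)`. -/
def sigma (q : ℕ) [NeZero q] : RatFunc K →ₐ[K] RatFunc K :=
  RatFunc.mapAlgHom (Polynomial.expand K q)
    (nonZeroDivisors_le_comap_nonZeroDivisors_of_injective _
      (Polynomial.expand_injective (NeZero.pos q)))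

theorem sigma_div (q : ℕ) [NeZero q] (a b : Polynomial K) :
    sigma q (algebraMap _ _ a / algebraMap _ _ b : RatFunc K) =
      algebraMap _ _ (Polynomial.expand K q a) / algebraMap _ _ (Polynomial.expand K q b) := by
  rw [sigma, RatFunc.coe_mapAlgHom_eq_coe_map, RatFunc.map_apply_div]

theorem sigma_algebraMap (q : ℕ) [NeZero q] (a : Polynomial K) :
    sigma q (algebraMap _ _ a : RatFunc K) = algebraMap _ _ (Polynomial.expand K q a) := by
  have := sigma_div q a 1
  simpa only [map_one, div_one] using this

theorem mahlerOp_eq_sigma (p : ℕ) [NeZero p] (f : RatFunc K) : mahlerOp p f = sigma p f := by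
  have h (a : Polynomial K) : a.eval₂ (algebraMap K (RatFunc K)) (RatFunc.X ^ p) =
      algebraMap _ _ (Polynomial.expand K p a) := by
    rw [Polynomial.expand_eq_comp_X_pow, Polynomial.comp, Polynomial.hom_eval₂, map_pow,
      RatFunc.algebraMap_X, RatFunc.algebraMap_comp_C]
    rfl
  conv_rhs => rw [← RatFunc.num_div_denom f, sigma_div]
  rw [mahlerOp, RatFunc.eval, h, h]

theorem sigma_sigma (p a b : ℕ) [NeZero p] (f : RatFunc K) :
    sigma (p ^ a) (sigma (p ^ b) f) = sigma (p ^ (a + b)) f := by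
  rw [← RatFunc.num_div_denom f, sigma_div, sigma_div, sigma_div]
  simp only [Polynomial.expand_expand, pow_add]

theorem sigma_pow_zero (p : ℕ) [NeZero p] (f : RatFunc K) : sigma (p ^ 0) f = f := by
  conv_lhs => rw [← RatFunc.num_div_denom f, sigma_div]
  simp only [pow_zero, Polynomial.expand_one, RatFunc.num_div_denom]

theorem sigma_pow_one (p : ℕ) [NeZero p] (f : RatFunc K) : sigma (p ^ 1) f = sigma p f := by
  rw [← RatFunc.num_div_denom f, sigma_div, sigma_div]
  simp only [pow_one]

theorem sigma_C_div_pow (q : ℕ) [NeZero q] (c β : K) (s : ℕ) :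
    sigma q (RatFunc.C c / (RatFunc.X - RatFunc.C β) ^ s) =
      c • (1 / (RatFunc.X ^ q - RatFunc.C β) ^ s) := by
  rw [map_div₀, map_pow, map_sub, ← RatFunc.algebraMap_C, ← RatFunc.algebraMap_C,
    ← RatFunc.algebraMap_X, sigma_algebraMap, sigma_algebraMap, sigma_algebraMap,
    RatFunc.smul_eq_C_mul]
  simp only [Polynomial.expand_C, Polynomial.expand_X, map_pow, RatFunc.algebraMap_C,
    RatFunc.algebraMap_X, mul_one_div]

theorem RegularAt.sigma {q : ℕ} [NeZero q] {f : RatFunc K} {α : K} (h : RegularAt f (α ^ q)) :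
    RegularAt (sigma q f) α := by
  refine regularAt_of_eq_div (a := Polynomial.expand K q f.num)
    (b := Polynomial.expand K q f.denom) ?_ ?_
  · rwa [Polynomial.expand_eval]
  · rw [← sigma_div, RatFunc.num_div_denom]

/-! ### Principal parts -/

/-- The principal part of `f` at `α`. -/
def principalPart (f : RatFunc K) (α : K) : RatFunc K :=
  ∑ k ∈ Finset.Icc 1 (poleOrder f α),
    RatFunc.C (pfCoeff f α k) / (RatFunc.X - RatFunc.C α) ^ k

theorem pfCoeff_principalPart (f : RatFunc K) (α β : K) {k : ℕ} (hk : 1 ≤ k) :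
    pfCoeff (principalPart f α) β k = if β = α then pfCoeff f α k else 0 := by
  rw [← pfLin_apply, principalPart, map_sum]
  simp only [pfLin_apply, pfCoeff_C_div_pow _ _ _ _ _ hk]
  by_cases h : β = α
  · simp only [h, true_and, if_true]
    rw [Finset.sum_ite_eq]
    split_ifs with h1
    · rfl
    · rw [pfCoeff_eq_zero_of_lt]
      simpa [hk] using h1
  · simp [h]

theorem regularAt_sub_principalPart (f : RatFunc K) (α : K) :
    RegularAt (f - principalPart f α) α := by
  refine regularAt_of_pfCoeff_eq_zero fun k hk => ?_
  rw [← pfLin_apply, map_sub, pfLin_apply, pfLin_apply, pfCoeff_principalPart _ _ _ hk, if_pos rfl,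
    sub_self]

/-- The part of the partial fraction decomposition of `f` with poles in `P`. -/
def restrictPoles (P : Set K) (f : RatFunc K) : RatFunc K :=
  ∑ α ∈ f.denom.roots.toFinset.filter fun α => α ∈ P, principalPart f α

theorem component_eq_restrictPoles {p : ℕ} (τ : MahlerTree K p) (f : RatFunc K) :
    τ.component f = restrictPoles τ.carrier f := rfl

theorem regularAt_of_notMem_roots {f : RatFunc K} {α : K} (h : α ∉ f.denom.roots.toFinset) :
    RegularAt f α := by
  simpa [RatFunc.denom_ne_zero, RegularAt] using h

theorem pfCoeff_restrictPoles (P : Set K) (f : RatFunc K) (β : K) {k : ℕ} (hk : 1 ≤ k) :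
    pfCoeff (restrictPoles P f) β k = if β ∈ P then pfCoeff f β k else 0 := by
  rw [← pfLin_apply, restrictPoles, map_sum]
  simp only [pfLin_apply, pfCoeff_principalPart _ _ _ hk]
  rw [Finset.sum_ite_eq]
  simp only [Finset.mem_filter]
  by_cases h : β ∈ P
  · simp only [h, and_true, if_true]
    split_ifs with h1
    · rfl
    · rw [pfCoeff_eq_zero_of_regularAt (regularAt_of_notMem_roots h1) hk]
  · simp [h]

/-- Only the principal part of `f` at `α ^ p ^ n` contributes: the rest is regular there, so its
image is regular at `α`. The Mahler coefficients then appear by definition. -/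
theorem pfCoeff_sigma_pow (p n : ℕ) [NeZero p] (f : RatFunc K) (α : K) {k : ℕ} (hk : 1 ≤ k) :
    pfCoeff (sigma (p ^ n) f) α k = ∑ s ∈ Finset.Icc 1 (poleOrder f (α ^ p ^ n)),
      mahlerCoeff p s k n α * pfCoeff f (α ^ p ^ n) s := by
  have h1 : pfCoeff (sigma (p ^ n) (f - principalPart f (α ^ p ^ n))) α k = 0 :=
    pfCoeff_eq_zero_of_regularAt (regularAt_sub_principalPart _ _).sigma hk
  rw [map_sub, ← pfLin_apply, map_sub, pfLin_apply, pfLin_apply, sub_eq_zero] at h1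
  rw [h1, principalPart, map_sum, ← pfLin_apply, map_sum]
  refine Finset.sum_congr rfl fun s _ => ?_
  rw [sigma_C_div_pow, map_smul, pfLin_apply, smul_eq_mul, mul_comm]
  rfl

/-! ### Rational functions vanishing at infinity -/

/-- `f` vanishes at infinity. -/
def IsProper (f : RatFunc K) : Prop := RatFunc.inftyValuation K f < 1

theorem IsProper.sub {f g : RatFunc K} (hf : IsProper f) (hg : IsProper g) : IsProper (f - g) :=
  (RatFunc.inftyValuation K).map_sub_lt hf hg

theorem IsProper.sum {ι : Type*} {s : Finset ι} {f : ι → RatFunc K}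
    (h : ∀ i ∈ s, IsProper (f i)) : IsProper (∑ i ∈ s, f i) :=
  (RatFunc.inftyValuation K).map_sum_lt one_ne_zero h

theorem inftyValuation_algebraMap {a : Polynomial K} (ha : a ≠ 0) :
    RatFunc.inftyValuation K (algebraMap _ _ a) = WithZero.exp (a.natDegree : ℤ) :=
  RatFunc.inftyValuation.polynomial K ha

theorem IsProper.smul {f : RatFunc K} (hf : IsProper f) (c : K) : IsProper (c • f) := by
  rw [RatFunc.smul_eq_C_mul]
  by_cases hc : c = 0
  · simp [hc, IsProper]
  · rwa [IsProper, map_mul, RatFunc.inftyValuation.C K hc, one_mul]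

theorem isProper_iff {f : RatFunc K} (hf : f ≠ 0) :
    IsProper f ↔ f.num.natDegree < f.denom.natDegree := by
  conv_lhs => rw [IsProper, ← RatFunc.num_div_denom f, map_div₀,
    inftyValuation_algebraMap (RatFunc.num_ne_zero hf),
    inftyValuation_algebraMap (RatFunc.denom_ne_zero f)]
  rw [← WithZero.exp_sub, ← WithZero.exp_zero, WithZero.exp_lt_exp]
  omega

theorem IsProper.sigma {f : RatFunc K} (hf : IsProper f) (q : ℕ) [NeZero q] :
    IsProper (sigma q f) := by
  by_cases h0 : f = 0
  · simp [h0, IsProper]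
  rw [isProper_iff h0] at hf
  conv => rw [IsProper, ← RatFunc.num_div_denom f, sigma_div, map_div₀]
  rw [inftyValuation_algebraMap
      ((Polynomial.expand_ne_zero (NeZero.pos q)).2 (RatFunc.num_ne_zero h0)),
    inftyValuation_algebraMap
      ((Polynomial.expand_ne_zero (NeZero.pos q)).2 (RatFunc.denom_ne_zero f)),
    Polynomial.natDegree_expand, Polynomial.natDegree_expand,
    ← WithZero.exp_sub, ← WithZero.exp_zero, WithZero.exp_lt_exp]
  have := Nat.mul_lt_mul_of_pos_right hf (NeZero.pos q)
  omega

theorem isProper_C_div_pow (c α : K) {k : ℕ} (hk : 1 ≤ k) :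
    IsProper (RatFunc.C c / (RatFunc.X - RatFunc.C α) ^ k) := by
  have h : (RatFunc.C c / (RatFunc.X - RatFunc.C α) ^ k : RatFunc K) =
      c • (1 / algebraMap _ _ ((Polynomial.X - Polynomial.C α) ^ k)) := by
    rw [RatFunc.smul_eq_C_mul, mul_one_div, map_pow, map_sub, RatFunc.algebraMap_X,
      RatFunc.algebraMap_C]
  rw [h]
  refine IsProper.smul ?_ c
  rw [IsProper, map_div₀, map_one, inftyValuation_algebraMap
    (pow_ne_zero _ (Polynomial.X_sub_C_ne_zero α)), Polynomial.natDegree_pow,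
    Polynomial.natDegree_X_sub_C, one_div, ← WithZero.exp_neg, ← WithZero.exp_zero,
    WithZero.exp_lt_exp]
  omega

theorem isProper_restrictPoles (P : Set K) (f : RatFunc K) : IsProper (restrictPoles P f) :=
  IsProper.sum fun _ _ => IsProper.sum fun _ hk =>
    isProper_C_div_pow _ _ (Finset.mem_Icc.1 hk).1

/-- A nonzero proper function has a nonconstant denominator, hence a pole. This turns equality of
proper functions into equality of principal parts. -/
theorem eq_zero_of_isProper [IsAlgClosed K] {f : RatFunc K} (hf : IsProper f)
    (h : ∀ α k, 1 ≤ k → pfCoeff f α k = 0) : f = 0 := by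
  by_contra h0
  rw [isProper_iff h0] at hf
  have hd : f.denom.degree ≠ 0 := by
    rw [Polynomial.degree_eq_natDegree (RatFunc.denom_ne_zero f)]
    intro h1
    have : f.denom.natDegree = 0 := by exact_mod_cast h1
    omega
  obtain ⟨α, hα⟩ := IsAlgClosed.exists_root f.denom hd
  exact regularAt_of_pfCoeff_eq_zero (h α) hα

end

/-! ### Explicit form of the Mahler coefficients -/

section

variable {K : Type*} [Field K]

theorem constantCoeff_geom (F : Type*) [Field F] (q : ℕ) :
    PowerSeries.constantCoeff (∑ i ∈ Finset.range q, (1 + PowerSeries.X : PowerSeries F) ^ i) =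
      (q : F) := by
  simp

theorem map_inv_powerSeries {F : Type*} [Field F] (φ : F →+* K) {u : PowerSeries F}
    (hu : PowerSeries.constantCoeff u ≠ 0) :
    PowerSeries.map φ u⁻¹ = (PowerSeries.map φ u)⁻¹ := by
  have h : PowerSeries.constantCoeff (PowerSeries.map φ u) ≠ 0 := by
    rw [← PowerSeries.coeff_zero_eq_constantCoeff_apply, PowerSeries.coeff_map]
    simpa using hu
  rw [PowerSeries.eq_inv_iff_mul_eq_one h, ← map_mul, PowerSeries.inv_mul_cancel _ hu, map_one]

theorem rescale_inv_powerSeries (a : K) {u : PowerSeries K}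
    (hu : PowerSeries.constantCoeff u ≠ 0) :
    PowerSeries.rescale a u⁻¹ = (PowerSeries.rescale a u)⁻¹ := by
  have h : PowerSeries.constantCoeff (PowerSeries.rescale a u) ≠ 0 := by
    rw [← PowerSeries.coeff_zero_eq_constantCoeff_apply, PowerSeries.coeff_rescale]
    simpa using hu
  rw [PowerSeries.eq_inv_iff_mul_eq_one h, ← map_mul, PowerSeries.inv_mul_cancel _ hu, map_one]

theorem pow_inv_powerSeries (u : PowerSeries K) (s : ℕ) : (u ^ s)⁻¹ = u⁻¹ ^ s := by
  induction s with
  | zero => rw [pow_zero, pow_zero, PowerSeries.inv_eq_iff_mul_eq_one] <;> simp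
  | succ s ih => rw [pow_succ, PowerSeries.mul_inv_rev, ih, pow_succ']

theorem univCoeff_cast [CharZero K] (p s k n : ℕ) [NeZero p] : (univCoeff p s k n : K) =
    PowerSeries.coeff (s - k)
      ((∑ i ∈ Finset.range (p ^ n), (1 + PowerSeries.X : PowerSeries K) ^ i)⁻¹ ^ s) := by
  have h := map_inv_powerSeries (Rat.castHom K) (u := ∑ i ∈ Finset.range (p ^ n),
    (1 + PowerSeries.X : PowerSeries ℚ) ^ i) (by
      rw [constantCoeff_geom]; exact_mod_cast pow_ne_zero n (NeZero.ne p))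
  rw [map_sum] at h
  simp only [map_pow, map_add, map_one, PowerSeries.map_X] at h
  rw [← h, ← map_pow, PowerSeries.coeff_map]
  rfl

theorem univCoeff_self [CharZero K] (p s n : ℕ) [NeZero p] :
    (univCoeff p s s n : K) = ((p : K) ^ (n * s))⁻¹ := by
  rw [univCoeff_cast, Nat.sub_self, PowerSeries.coeff_zero_eq_constantCoeff_apply, map_pow,
    PowerSeries.constantCoeff_inv, constantCoeff_geom, inv_pow, Nat.cast_pow, pow_mul]

/-- The sum is homogeneous of degree `q - 1` in `(x, α)`, and with the local variable `t` one has `x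
= α (1 + t / α)`. -/
theorem taylor_geom_sum₂ {α : K} (hα : α ≠ 0) (q : ℕ) :
    (Polynomial.taylor α (∑ i ∈ Finset.range q, Polynomial.X ^ i *
      Polynomial.C α ^ (q - 1 - i)) : PowerSeries K) = PowerSeries.C (α ^ (q - 1)) *
        PowerSeries.rescale α⁻¹ (∑ i ∈ Finset.range q, (1 + PowerSeries.X) ^ i) := by
  have hmap : ∀ a : Polynomial K, (a : PowerSeries K) = Polynomial.coeToPowerSeries.ringHom a :=
    fun _ => rfl
  rw [map_sum, hmap, map_sum, map_sum, Finset.mul_sum]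
  refine Finset.sum_congr rfl fun i hi => ?_
  have hi' := Finset.mem_range.1 hi
  rw [← hmap]
  simp only [Polynomial.taylor_mul, Polynomial.taylor_pow, Polynomial.taylor_X, Polynomial.taylor_C,
    Polynomial.coe_mul,
    Polynomial.coe_pow, Polynomial.coe_add, Polynomial.coe_X, Polynomial.coe_C, map_pow, map_add,
    map_one, PowerSeries.rescale_X]
  have h1 : (PowerSeries.X + PowerSeries.C α : PowerSeries K) =
      PowerSeries.C α * (1 + PowerSeries.C α⁻¹ * PowerSeries.X) := by
    rw [mul_add, ← mul_assoc, ← map_mul, mul_inv_cancel₀ hα]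
    simp [add_comm]
  rw [h1, mul_pow, mul_right_comm, ← pow_add, show i + (q - 1 - i) = q - 1 by omega]

/-- Factor `x ^ q - α ^ q = (x - α) b(x)` with `q = p ^ n`. The scalar in `b ^ (-s)` contributes `α
^ (-(q - 1) s)` and the rescaling `α ^ (-(s - k))`, which together give the exponent `k - s q`. -/
theorem mahlerCoeff_eq [CharZero K] (p s k n : ℕ) [NeZero p] {α : K} (hα : α ≠ 0) :
    mahlerCoeff p s k n α =
      if k ≤ s then α ^ ((k : ℤ) - s * (p : ℤ) ^ n) * (univCoeff p s k n : K) else 0 := by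
  set q := p ^ n with hq
  have hq0 : q ≠ 0 := pow_ne_zero n (NeZero.ne p)
  set b : Polynomial K := ∑ i ∈ Finset.range q, Polynomial.X ^ i * Polynomial.C α ^ (q - 1 - i)
    with hb
  set U : PowerSeries K := ∑ i ∈ Finset.range q, (1 + PowerSeries.X) ^ i with hU
  have hU0 : PowerSeries.constantCoeff U ≠ 0 := by
    rw [hU, constantCoeff_geom]; exact_mod_cast hq0
  have htb : (Polynomial.taylor α b : PowerSeries K) =
      PowerSeries.C (α ^ (q - 1)) * PowerSeries.rescale α⁻¹ U := taylor_geom_sum₂ hα q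
  have hb0 : (b ^ s).eval α ≠ 0 := by
    rw [Polynomial.eval_pow]
    refine pow_ne_zero s ?_
    rw [← constantCoeff_taylor, htb, map_mul,
      ← PowerSeries.coeff_zero_eq_constantCoeff_apply (PowerSeries.rescale _ _), PowerSeries.coeff_rescale]
    simpa using ⟨fun h => absurd h hα, hU0⟩
  have hf : (1 / (RatFunc.X ^ q - RatFunc.C (α ^ q)) ^ s : RatFunc K) =
      algebraMap _ _ (1 : Polynomial K) /
        (algebraMap _ _ (b ^ s) * (RatFunc.X - RatFunc.C α) ^ s) := by
    have := congrArg (algebraMap (Polynomial K) (RatFunc K))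
      ((Commute.all (Polynomial.X : Polynomial K) (Polynomial.C α)).geom_sum₂_mul q)
    rw [← hb] at this
    simp only [map_mul, map_sub, map_pow, RatFunc.algebraMap_X, RatFunc.algebraMap_C] at this
    rw [map_one, map_pow, map_pow, ← mul_pow, this]
  rw [mahlerCoeff, ← hq, hf, pfCoeff_div _ _ _ hb0]
  split_ifs with hks
  swap
  · rfl
  have h3 : ((Polynomial.taylor α (b ^ s) : Polynomial K) : PowerSeries K)⁻¹ =
      PowerSeries.C ((α ^ (q - 1))⁻¹ ^ s) * PowerSeries.rescale α⁻¹ (U⁻¹ ^ s) := by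
    rw [Polynomial.taylor_pow, Polynomial.coe_pow, pow_inv_powerSeries, htb, PowerSeries.mul_inv_rev,
      ← rescale_inv_powerSeries _ hU0, mul_pow, ← map_pow (PowerSeries.rescale α⁻¹), PowerSeries.C_inv,
      ← map_pow PowerSeries.C, mul_comm]
  rw [h3, Polynomial.taylor_one, Polynomial.C_1, Polynomial.coe_one, one_mul,
    PowerSeries.coeff_C_mul, PowerSeries.coeff_rescale, univCoeff_cast, ← hq, ← mul_assoc]
  congr 1
  rw [← inv_pow, ← pow_mul, ← pow_add, inv_pow, ← zpow_natCast, ← zpow_neg]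
  congr 1
  push_cast [Nat.cast_sub hks, Nat.cast_sub (Nat.one_le_iff_ne_zero.2 hq0)]
  rw [hq]
  push_cast
  ring

theorem univCoeff_self_ne_zero [CharZero K] (p s n : ℕ) [NeZero p] :
    (univCoeff p s s n : K) ≠ 0 := by
  rw [univCoeff_self]
  exact inv_ne_zero (pow_ne_zero _ (Nat.cast_ne_zero.2 (NeZero.ne p)))

theorem pfCoeff_sigma [CharZero K] (p n : ℕ) [NeZero p] {f : RatFunc K} {α : K} (hα : α ≠ 0)
    {M : ℕ} (hM : ∀ s, M < s → pfCoeff f (α ^ p ^ n) s = 0) {k : ℕ} (hk : 1 ≤ k) :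
    pfCoeff (sigma (p ^ n) f) α k =
      ∑ s ∈ Finset.Icc k M, mahlerCoeff p s k n α * pfCoeff f (α ^ p ^ n) s := by
  rw [pfCoeff_sigma_pow p n f α hk]
  set N := max M (poleOrder f (α ^ p ^ n))
  trans ∑ s ∈ Finset.Icc 1 N, mahlerCoeff p s k n α * pfCoeff f (α ^ p ^ n) s
  · refine Finset.sum_subset (Finset.Icc_subset_Icc le_rfl (le_max_right _ _)) fun s hs hs' => ?_
    rw [pfCoeff_eq_zero_of_lt, mul_zero]
    simp only [Finset.mem_Icc] at hs hs'
    omega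
  · symm
    refine Finset.sum_subset (Finset.Icc_subset_Icc hk (le_max_left _ _)) fun s hs hs' => ?_
    simp only [Finset.mem_Icc] at hs hs'
    rcases lt_or_ge M s with h | h
    · rw [hM s h, mul_zero]
    · rw [mahlerCoeff_eq p s k n hα, if_neg (by omega), zero_mul]

theorem pfCoeff_sigma_congr [CharZero K] (p n : ℕ) [NeZero p] {f g : RatFunc K} {α : K}
    (h : ∀ s, 1 ≤ s → pfCoeff f (α ^ p ^ n) s = pfCoeff g (α ^ p ^ n) s) {k : ℕ}
    (hk : 1 ≤ k) : pfCoeff (sigma (p ^ n) f) α k = pfCoeff (sigma (p ^ n) g) α k := by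
  have h1 : RegularAt (f - g) (α ^ p ^ n) := regularAt_of_pfCoeff_eq_zero fun s hs => by
    rw [← pfLin_apply, map_sub, pfLin_apply, pfLin_apply, h s hs, sub_self]
  have := pfCoeff_eq_zero_of_regularAt (k := k) h1.sigma hk
  rwa [map_sub, ← pfLin_apply, map_sub, pfLin_apply, pfLin_apply, sub_eq_zero] at this

/-- If `f(x ^ p)` is regular at `α` then `f` is regular at `α ^ p`. -/
theorem pfCoeff_eq_zero_of_sigma [CharZero K] (p : ℕ) [NeZero p] {f : RatFunc K} {α : K}
    (hα : α ≠ 0) (h : ∀ k, 1 ≤ k → pfCoeff (sigma p f) α k = 0) :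
    ∀ k, 1 ≤ k → pfCoeff f (α ^ p) k = 0 := by
  by_contra! hne
  obtain ⟨k, hk, hne⟩ := hne
  have hpos : 0 < poleOrder f (α ^ p) := by
    by_contra h0
    exact hne (pfCoeff_eq_zero_of_lt (by omega))
  -- In degree equal to the pole order at `α ^ p` only the diagonal term `s = k` survives, and the
  -- diagonal Mahler coefficient is nonzero.
  have h1 := h _ hpos
  rw [← sigma_pow_one, pfCoeff_sigma p 1 hα (M := poleOrder f (α ^ p))
    (fun s hs => by rw [pow_one]; exact pfCoeff_eq_zero_of_lt hs) hpos, Finset.Icc_self,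
    Finset.sum_singleton, pow_one, mahlerCoeff_eq p _ _ 1 hα, if_pos le_rfl] at h1
  exact (mul_ne_zero (mul_ne_zero (zpow_ne_zero _ hα) (univCoeff_self_ne_zero p _ 1))
    (pfCoeff_poleOrder_ne_zero hpos)) h1

end

section

/-! ### Roots in an algebraically closed field of characteristic zero -/

/-- The finite set of `n`-th roots of `a`. -/
def rootSet {K : Type*} [Field K] (n : ℕ) (a : K) : Finset K :=
  (Polynomial.nthRoots n a).toFinset

theorem mem_rootSet {K : Type*} [Field K] {n : ℕ} (hn : 0 < n) {a x : K} :
    x ∈ rootSet n a ↔ x ^ n = a := by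
  rw [rootSet, Multiset.mem_toFinset, Polynomial.mem_nthRoots hn]

theorem card_rootSet {K : Type*} [Field K] [IsAlgClosed K] [CharZero K] {n : ℕ} (hn : 0 < n)
    {a : K} (ha : a ≠ 0) : (rootSet n a).card = n := by
  have hnd := Polynomial.nodup_roots (Polynomial.separable_X_pow_sub_C (F := K) (n := n) a
    (Nat.cast_ne_zero.2 hn.ne') ha)
  rw [rootSet, Polynomial.nthRoots, Multiset.toFinset_card_of_nodup hnd,
    IsAlgClosed.card_roots_eq_natDegree, Polynomial.natDegree_X_pow_sub_C]

/-! ### Heights, and the cycle as a single periodic orbit -/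

namespace MahlerTree

variable {K : Type*} [Field K] {p : ℕ} (τ : MahlerTree K p)

theorem ne_zero_of_mem {α : K} (h : α ∈ τ.carrier) : α ≠ 0 := by
  obtain ⟨a, _, hc⟩ := τ.isClass
  rw [hc] at h
  exact h.1

theorem pow_mem_carrier_iff [NeZero p] {α : K} {n : ℕ} :
    α ^ p ^ n ∈ τ.carrier ↔ α ∈ τ.carrier := by
  obtain ⟨a, _, hc⟩ := τ.isClass
  rw [hc]
  constructor
  · rintro ⟨h0, r, s, h⟩
    refine ⟨fun h1 => h0 (by rw [h1, zero_pow (pow_ne_zero _ (NeZero.ne p))]), r, n + s, ?_⟩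
    rw [h, pow_add, pow_mul]
  · rintro ⟨h0, r, s, h⟩
    refine ⟨pow_ne_zero _ h0, r + n, s, ?_⟩
    rw [pow_add, pow_mul, h, ← pow_mul, ← pow_mul, mul_comm]

theorem exists_pow_eq_pow {α β : K} (hα : α ∈ τ.carrier) (hβ : β ∈ τ.carrier) :
    ∃ r s : ℕ, α ^ p ^ r = β ^ p ^ s := by
  obtain ⟨a, _, hc⟩ := τ.isClass
  rw [hc] at hα hβ
  obtain ⟨-, r, s, h⟩ := hα
  obtain ⟨-, r', s', h'⟩ := hβ
  refine ⟨s + r', s' + r, ?_⟩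
  rw [pow_add, pow_mul, ← h, pow_add, pow_mul, ← h', ← pow_mul, ← pow_mul, mul_comm]

variable {τ}

theorem IsTorsion.nonempty_cycle (hτ : τ.IsTorsion) : τ.cycle.Nonempty := by
  by_contra h
  rw [Set.not_nonempty_iff_eq_empty] at h
  exact hτ (by rw [cycleLength, h, Set.ncard_empty])

theorem IsTorsion.height_spec (hτ : τ.IsTorsion) {α : K} (hα : α ∈ τ.carrier) :
    α ^ p ^ τ.height α ∈ τ.cycle := by
  obtain ⟨γ, hγ⟩ := hτ.nonempty_cycle
  obtain ⟨r, s, h⟩ := τ.exists_pow_eq_pow hα hγ.1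
  exact Nat.sInf_mem (s := {n : ℕ | α ^ (p ^ n) ∈ τ.cycle})
    ⟨r, by rw [Set.mem_ofPred_eq, h]; exact τ.pow_mem_cycle hγ s⟩

theorem IsTorsion.height_le_iff (hτ : τ.IsTorsion) {α : K} (hα : α ∈ τ.carrier) {n : ℕ} :
    τ.height α ≤ n ↔ α ^ p ^ n ∈ τ.cycle := by
  constructor
  · intro h
    obtain ⟨m, rfl⟩ := Nat.exists_eq_add_of_le h
    rw [pow_add, pow_mul]
    exact τ.pow_mem_cycle (hτ.height_spec hα) m
  · exact fun h => Nat.sInf_le h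

theorem IsTorsion.height_eq_zero_iff (hτ : τ.IsTorsion) {α : K} (hα : α ∈ τ.carrier) :
    τ.height α = 0 ↔ α ∈ τ.cycle := by
  rw [← Nat.le_zero, hτ.height_le_iff hα, pow_zero, pow_one]

theorem IsTorsion.height_pow [NeZero p] (hτ : τ.IsTorsion) {α : K} (hα : α ∈ τ.carrier) (n : ℕ) :
    τ.height (α ^ p ^ n) = τ.height α - n := by
  refine eq_of_forall_ge_iff fun m => ?_
  rw [hτ.height_le_iff (τ.pow_mem_carrier_iff.2 hα), ← pow_mul, ← pow_add,
    ← hτ.height_le_iff hα]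
  omega

/-- Raising to the power `p ^ n` preserves orders on the cycle, so `β / γ` is killed both by the
order of `γ` and by `p ^ n`, which are coprime. -/
theorem cycle_pow_injective {β γ : K} (hβ : β ∈ τ.cycle) (hγ : γ ∈ τ.cycle) {n : ℕ}
    (h : β ^ p ^ n = γ ^ p ^ n) : β = γ := by
  have hγ0 := τ.ne_zero_of_mem hγ.1
  have ho : orderOf β = orderOf γ := by
    have := congrArg orderOf h
    rwa [(hβ.2.2.pow_right _).orderOf_pow, (hγ.2.2.pow_right _).orderOf_pow] at this
  have h1 : (β / γ) ^ orderOf γ = 1 := by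
    rw [div_pow, pow_orderOf_eq_one, div_one, ← ho, pow_orderOf_eq_one]
  have h2 : (β / γ) ^ p ^ n = 1 := by
    rw [div_pow, h, div_self (pow_ne_zero _ hγ0)]
  have h3 := pow_gcd_eq_one.2 ⟨h1, h2⟩
  rw [(hγ.2.2.pow_right n), pow_one, div_eq_one_iff_eq hγ0] at h3
  exact h3

@[simp]
theorem coe_cyclePow (n : ℕ) (γ : τ.cycle) : (τ.cyclePow n γ : K) = (γ : K) ^ p ^ n := rfl

theorem cyclePow_cyclePow (m n : ℕ) (γ : τ.cycle) :
    τ.cyclePow m (τ.cyclePow n γ) = τ.cyclePow (m + n) γ := by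
  ext
  simp only [coe_cyclePow]
  rw [← pow_mul, ← pow_add, add_comm]

theorem cyclePow_zero (γ : τ.cycle) : τ.cyclePow 0 γ = γ := by
  ext; simp

theorem cyclePow_injective (n : ℕ) : Function.Injective (τ.cyclePow n) := fun β γ h =>
  Subtype.ext (cycle_pow_injective β.2 γ.2 (congrArg Subtype.val h))

theorem iterate_cyclePow (n : ℕ) (γ : τ.cycle) : (τ.cyclePow 1)^[n] γ = τ.cyclePow n γ := by
  induction n with
  | zero => rw [cyclePow_zero]; rfl
  | succ n ih => rw [Function.iterate_succ_apply', ih, cyclePow_cyclePow, add_comm]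

theorem mem_periodicPts_cyclePow (γ : τ.cycle) :
    γ ∈ Function.periodicPts (τ.cyclePow 1) := by
  refine Function.mk_mem_periodicPts (n := (orderOf (γ : K)).totient)
    (Nat.totient_pos.2 γ.2.2.1.orderOf_pos) ?_
  rw [Function.IsPeriodicPt, Function.IsFixedPt, iterate_cyclePow]
  ext
  rw [coe_cyclePow]
  conv_rhs => rw [← pow_one (γ : K)]
  -- Euler's theorem: `p ^ φ(N) ≡ 1` modulo the order `N` of `γ`.
  exact pow_eq_pow_of_modEq (Nat.ModEq.pow_totient γ.2.2.2.symm) (pow_orderOf_eq_one _)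

theorem exists_cyclePow_eq (γ δ : τ.cycle) : ∃ j, τ.cyclePow j γ = δ := by
  obtain ⟨r, s, h⟩ := τ.exists_pow_eq_pow γ.2.1 δ.2.1
  obtain ⟨n, hn, hper⟩ := Function.mem_periodicPts.1 (mem_periodicPts_cyclePow δ)
  have h1 : τ.cyclePow r γ = τ.cyclePow s δ := Subtype.ext h
  have h2 : τ.cyclePow (s * n) δ = δ := by
    rw [← iterate_cyclePow]
    exact hper.const_mul s
  -- After `r` steps `γ` meets the point `s` steps beyond `δ`; the remaining `s * n - s` steps
  -- complete `s` periods of `δ`.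
  refine ⟨(s * n - s) + r, ?_⟩
  rw [← cyclePow_cyclePow, h1, cyclePow_cyclePow,
    Nat.sub_add_cancel (Nat.le_mul_of_pos_right s hn), h2]

theorem cycleLength_eq_card : τ.cycleLength = Fintype.card τ.cycle := by
  rw [cycleLength, Set.ncard_eq_toFinset_card', Set.toFinset_card]

theorem bijOn_cyclePow (γ : τ.cycle) :
    Set.BijOn (fun j => τ.cyclePow j γ)
      (Set.Iio (Function.minimalPeriod (τ.cyclePow 1) γ)) Set.univ := by
  refine ⟨fun _ _ => Set.mem_univ _, ?_, ?_⟩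
  · intro i hi j hj hij
    refine (Function.iterate_injOn_Iio_minimalPeriod (f := τ.cyclePow 1) (x := γ)) hi hj ?_
    simpa only [iterate_cyclePow] using hij
  · intro δ _
    obtain ⟨j, rfl⟩ := exists_cyclePow_eq γ δ
    refine ⟨j % Function.minimalPeriod (τ.cyclePow 1) γ, Nat.mod_lt _
      (Function.minimalPeriod_pos_of_mem_periodicPts (mem_periodicPts_cyclePow γ)), ?_⟩
    simp only [← iterate_cyclePow]
    exact Function.iterate_mod_minimalPeriod_eq

theorem minimalPeriod_cyclePow (γ : τ.cycle) :
    Function.minimalPeriod (τ.cyclePow 1) γ = τ.cycleLength := by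
  have h := (bijOn_cyclePow γ).image_eq
  have h1 := congrArg Set.ncard h
  rw [(bijOn_cyclePow γ).injOn.ncard_image, Set.ncard_univ, Nat.card_eq_fintype_card,
    ← cycleLength_eq_card] at h1
  rw [← h1]
  simp [Set.ncard_eq_toFinset_card']

theorem cyclePow_cycleLength (γ : τ.cycle) : τ.cyclePow τ.cycleLength γ = γ := by
  rw [← minimalPeriod_cyclePow γ, ← iterate_cyclePow]
  exact Function.iterate_minimalPeriod

theorem sum_cyclePow {M : Type*} [AddCommMonoid M] (F : τ.cycle → M) (γ : τ.cycle) :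
    ∑ j ∈ Finset.range τ.cycleLength, F (τ.cyclePow j γ) = ∑ δ, F δ := by
  have h := bijOn_cyclePow γ
  rw [minimalPeriod_cyclePow] at h
  refine Finset.sum_bij (fun j _ => τ.cyclePow j γ) (fun _ _ => Finset.mem_univ _) ?_ ?_
    fun _ _ => rfl
  · exact fun i hi j hj hij => h.injOn (by simpa using hi) (by simpa using hj) hij
  · intro δ _
    obtain ⟨j, hj, hjδ⟩ := h.surjOn (Set.mem_univ δ)
    exact ⟨j, by simpa using hj, hjδ⟩

/-- There are `p ≥ 2` distinct `p`-th roots and at most one lies on the cycle. Any other root has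
height one more, so no branch of the tree ends. -/
theorem IsTorsion.exists_root [NeZero p] [IsAlgClosed K] [CharZero K] (hp : 2 ≤ p)
    (hτ : τ.IsTorsion) {α : K} (hα : α ∈ τ.carrier) :
    ∃ β ∈ τ.carrier, β ^ p = α ∧ τ.height β = τ.height α + 1 := by
  have hc : 1 < (rootSet p α).card := by
    rw [card_rootSet (by omega) (τ.ne_zero_of_mem hα)]; omega
  have key : ∃ β ∈ rootSet p α, β ∉ τ.cycle := by
    obtain ⟨a, ha, b, hb, hab⟩ := Finset.one_lt_card.1 hc
    by_contra! h
    rw [mem_rootSet (by omega)] at ha hb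
    exact hab (cycle_pow_injective (n := 1) (h a ((mem_rootSet (by omega)).2 ha))
      (h b ((mem_rootSet (by omega)).2 hb)) (by rw [pow_one, ha, hb]))
  obtain ⟨β, hβ, hβc⟩ := key
  rw [mem_rootSet (by omega)] at hβ
  have hβτ : β ∈ τ.carrier := by
    rw [← τ.pow_mem_carrier_iff (n := 1), pow_one, hβ]; exact hα
  refine ⟨β, hβτ, hβ, ?_⟩
  have h1 := hτ.height_pow hβτ 1
  rw [pow_one, hβ] at h1
  rw [← hτ.height_eq_zero_iff hβτ] at hβc
  omega

/-! ### Summation over a level -/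

theorem pow_add_cycleLength {α : K} {n : ℕ} (h : α ^ p ^ n ∈ τ.cycle) :
    α ^ p ^ (n + τ.cycleLength) = α ^ p ^ n := by
  rw [pow_add, pow_mul]
  exact congrArg Subtype.val (cyclePow_cycleLength (⟨_, h⟩ : τ.cycle))

theorem IsTorsion.one_le_cycleLength (hτ : τ.IsTorsion) : 1 ≤ τ.cycleLength :=
  Nat.one_le_iff_ne_zero.2 hτ

/-- Going `h` steps up to the cycle and then `e - 1` steps around it leads to `γ` exactly when the
first `h` steps lead to `γ ^ p`. Among such `α`, those of height below `h` are the ones already at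
`γ` after `h - 1` steps. -/
theorem IsTorsion.mem_level_fiber [NeZero p] (hτ : τ.IsTorsion) {h : ℕ} (hh : 1 ≤ h) {γ : K}
    (hγ : γ ∈ τ.cycle) (α : K) :
    α ∈ τ.level h ∧ α ^ p ^ (h + τ.cycleLength - 1) = γ ↔
      α ∈ rootSet (p ^ h) (γ ^ p) \ rootSet (p ^ (h - 1)) γ := by
  have he := hτ.one_le_cycleLength
  have hγe : γ ^ p ^ τ.cycleLength = γ :=
    congrArg Subtype.val (cyclePow_cycleLength (⟨_, hγ⟩ : τ.cycle))
  have hγp : γ ^ p ∈ τ.cycle := by simpa using τ.pow_mem_cycle hγ 1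
  rw [Finset.mem_sdiff, mem_rootSet (pow_pos (NeZero.pos p) _),
    mem_rootSet (pow_pos (NeZero.pos p) _)]
  constructor
  · rintro ⟨⟨hα, hht⟩, h1⟩
    have h2 : α ^ p ^ h ∈ τ.cycle := (hτ.height_le_iff hα).1 hht.le
    refine ⟨?_, fun h3 => ?_⟩
    · rw [← h1, ← pow_mul, ← pow_succ,
        show h + τ.cycleLength - 1 + 1 = h + τ.cycleLength by omega, pow_add_cycleLength h2]
    · have := (hτ.height_le_iff hα (n := h - 1)).2 (by rw [h3]; exact hγ)
      omega
  · rintro ⟨h1, h2⟩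
    have hα : α ∈ τ.carrier := by
      rw [← τ.pow_mem_carrier_iff (n := h), h1]; exact hγp.1
    have hle : τ.height α ≤ h := (hτ.height_le_iff hα).2 (by rw [h1]; exact hγp)
    refine ⟨⟨hα, ?_⟩, ?_⟩
    · by_contra hne
      have h3 : α ^ p ^ (h - 1) ∈ τ.cycle := (hτ.height_le_iff hα).1 (by omega)
      refine h2 (cycle_pow_injective (n := 1) h3 hγ ?_)
      rw [← pow_mul, ← pow_add, Nat.sub_add_cancel hh, h1, pow_one]
    · rw [Nat.add_sub_assoc he, pow_add, pow_mul, h1, ← pow_mul, ← pow_succ',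
        Nat.sub_add_cancel he, hγe]

theorem IsTorsion.finite_level [NeZero p] (hτ : τ.IsTorsion) (h : ℕ) : (τ.level h).Finite := by
  refine Set.Finite.subset (τ.finite_cycle.toFinset.biUnion fun γ =>
    rootSet (p ^ h) γ).finite_toSet ?_
  rintro α ⟨hα, hht⟩
  simp only [Finset.coe_biUnion, Set.mem_iUnion, Finset.mem_coe, Set.Finite.mem_toFinset]
  exact ⟨_, (hτ.height_le_iff hα).1 hht.le, (mem_rootSet (pow_pos (NeZero.pos p) _)).2 rfl⟩

/-- Each fibre over the cycle is a difference of nested root sets with `p ^ h` and `p ^ (h - 1)`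
elements; this is the normalizing factor in the residual average. -/
theorem IsTorsion.finsum_level [NeZero p] [IsAlgClosed K] [CharZero K] (hτ : τ.IsTorsion)
    {h : ℕ} (hh : 1 ≤ h) (G : K → K) :
    ∑ᶠ α ∈ τ.level h, G (α ^ p ^ (h + τ.cycleLength - 1)) =
      ((p : K) ^ h - (p : K) ^ (h - 1)) * ∑ γ : τ.cycle, G γ := by
  have he := hτ.one_le_cycleLength
  rw [finsum_mem_eq_finite_toFinset_sum _ (hτ.finite_level h)]
  have hmaps : ∀ α ∈ (hτ.finite_level h).toFinset,
      α ^ p ^ (h + τ.cycleLength - 1) ∈ τ.finite_cycle.toFinset := by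
    intro α hα
    rw [Set.Finite.mem_toFinset] at hα ⊢
    exact (hτ.height_le_iff hα.1).1 (by have := hα.2; omega)
  rw [← Finset.sum_fiberwise_of_maps_to hmaps, Finset.mul_sum]
  have h2 : ∑ γ : τ.cycle, ((p : K) ^ h - (p : K) ^ (h - 1)) * G γ =
      ∑ γ ∈ τ.finite_cycle.toFinset, ((p : K) ^ h - (p : K) ^ (h - 1)) * G γ :=
    (Finset.sum_subtype τ.finite_cycle.toFinset (fun _ => Set.Finite.mem_toFinset _)
      fun γ => ((p : K) ^ h - (p : K) ^ (h - 1)) * G γ).symm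
  rw [h2]
  refine Finset.sum_congr rfl fun γ hγ => ?_
  rw [Set.Finite.mem_toFinset] at hγ
  have h3 : {α ∈ (hτ.finite_level h).toFinset | α ^ p ^ (h + τ.cycleLength - 1) = γ} =
      rootSet (p ^ h) (γ ^ p) \ rootSet (p ^ (h - 1)) γ := by
    ext α
    rw [Finset.mem_filter, Set.Finite.mem_toFinset, hτ.mem_level_fiber hh hγ]
  have hsub : rootSet (p ^ (h - 1)) γ ⊆ rootSet (p ^ h) (γ ^ p) := by
    intro α
    rw [mem_rootSet (pow_pos (NeZero.pos p) _), mem_rootSet (pow_pos (NeZero.pos p) _)]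
    rintro rfl
    rw [← pow_mul, ← pow_succ, Nat.sub_add_cancel hh]
  have hγ0 := τ.ne_zero_of_mem hγ.1
  rw [Finset.sum_congr rfl (g := fun _ => G γ) fun α hα => by rw [(Finset.mem_filter.1 hα).2],
    Finset.sum_const, h3, Finset.card_sdiff_of_subset hsub,
    card_rootSet (pow_pos (NeZero.pos p) _) (pow_ne_zero _ hγ0),
    card_rootSet (pow_pos (NeZero.pos p) _) hγ0, nsmul_eq_mul,
    Nat.cast_sub (Nat.pow_le_pow_right (NeZero.pos p) (Nat.sub_le _ _))]
  push_cast
  rfl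

end MahlerTree

end

section

namespace MahlerTree

variable {K : Type*} [Field K] {p : ℕ} {τ : MahlerTree K p}

/-! ### Twisted difference equations on the cycle -/

/-- With `T(γ) = ∑ q ^ j B(γ ^ p ^ j)`, the product `q T(γ ^ p)` is `T(γ)` with its index shifted by
one. The difference telescopes to `(q ^ e - 1) B(γ)`, because the cycle closes after `e` steps. -/
theorem twisted_solve {q : K} (hq : q ^ τ.cycleLength ≠ 1) (B : τ.cycle → K) (γ : τ.cycle) :
    q * (1 / (q ^ τ.cycleLength - 1) *
        ∑ j ∈ Finset.range τ.cycleLength, q ^ j * B (τ.cyclePow j (τ.cyclePow 1 γ))) -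
      1 / (q ^ τ.cycleLength - 1) *
        ∑ j ∈ Finset.range τ.cycleLength, q ^ j * B (τ.cyclePow j γ) = B γ := by
  have h0 : q ^ τ.cycleLength - 1 ≠ 0 := sub_ne_zero.2 hq
  have h1 := Finset.sum_range_succ' (fun j => q ^ j * B (τ.cyclePow j γ)) τ.cycleLength
  rw [Finset.sum_range_succ, cyclePow_cycleLength, cyclePow_zero, pow_zero, one_mul] at h1
  have h2 : q * ∑ j ∈ Finset.range τ.cycleLength, q ^ j * B (τ.cyclePow j (τ.cyclePow 1 γ)) =
      ∑ j ∈ Finset.range τ.cycleLength, q ^ (j + 1) * B (τ.cyclePow (j + 1) γ) := by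
    rw [Finset.mul_sum]
    refine Finset.sum_congr rfl fun j _ => ?_
    rw [cyclePow_cyclePow, pow_succ']
    ring
  rw [mul_left_comm, h2, ← mul_sub, eq_sub_of_add_eq h1.symm]
  field_simp
  ring

/-- For `q = 1` only functions of mean zero are differences, so the equation is solved up to the
mean of `B`. The weights `j + 1 - e` arise from summation by parts. -/
theorem untwisted_solve [CharZero K] (hτ : τ.IsTorsion) (B : τ.cycle → K) (γ : τ.cycle) :
    1 / (τ.cycleLength : K) * ∑ j ∈ Finset.range τ.cycleLength,
        ((j : K) + 1 - τ.cycleLength) * B (τ.cyclePow j (τ.cyclePow 1 γ)) -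
      1 / (τ.cycleLength : K) * ∑ j ∈ Finset.range τ.cycleLength,
        ((j : K) + 1 - τ.cycleLength) * B (τ.cyclePow j γ) =
      B γ - 1 / (τ.cycleLength : K) * ∑ δ, B δ := by
  have he : (τ.cycleLength : K) ≠ 0 := Nat.cast_ne_zero.2 hτ
  have h1 := Finset.sum_range_succ'
    (fun j => ((j : K) - τ.cycleLength) * B (τ.cyclePow j γ)) τ.cycleLength
  rw [Finset.sum_range_succ, sub_self, zero_mul, add_zero, cyclePow_zero] at h1
  push_cast at h1
  have h2 : ∑ j ∈ Finset.range τ.cycleLength,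
        ((j : K) + 1 - τ.cycleLength) * B (τ.cyclePow j (τ.cyclePow 1 γ)) =
      ∑ j ∈ Finset.range τ.cycleLength,
        ((j : K) + 1 - τ.cycleLength) * B (τ.cyclePow (j + 1) γ) := by
    simp only [cyclePow_cyclePow]
  have h3 : ∑ j ∈ Finset.range τ.cycleLength,
        ((j : K) + 1 - τ.cycleLength) * B (τ.cyclePow j γ) =
      ∑ j ∈ Finset.range τ.cycleLength, ((j : K) - τ.cycleLength) * B (τ.cyclePow j γ) +
        ∑ δ, B δ := by
    rw [← sum_cyclePow B γ, ← Finset.sum_add_distrib]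
    refine Finset.sum_congr rfl fun j _ => ?_
    ring
  rw [h2, h3, h1]
  field_simp
  ring

theorem twisted_injective {q : K} (hq : q ^ τ.cycleLength ≠ 1) {D : τ.cycle → K}
    (h : ∀ γ, q * D (τ.cyclePow 1 γ) = D γ) (γ : τ.cycle) : D γ = 0 := by
  have h1 (n : ℕ) : q ^ n * D (τ.cyclePow n γ) = D γ := by
    induction n with
    | zero => rw [cyclePow_zero, pow_zero, one_mul]
    | succ n ih => rw [add_comm, ← cyclePow_cyclePow, add_comm, pow_succ, mul_assoc, h, ih]
  have h2 := h1 τ.cycleLength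
  rw [cyclePow_cycleLength] at h2
  by_contra h0
  exact hq (mul_right_cancel₀ h0 (by rw [h2, one_mul]))

theorem eq_of_cyclePow_invariant {D : τ.cycle → K} (h : ∀ γ, D (τ.cyclePow 1 γ) = D γ)
    (γ δ : τ.cycle) : D δ = D γ := by
  obtain ⟨j, rfl⟩ := exists_cyclePow_eq γ δ
  rw [← iterate_cyclePow]
  induction j with
  | zero => rfl
  | succ n ih => rw [Function.iterate_succ_apply', h, ih]

theorem sum_comp_cyclePow (D : τ.cycle → K) : ∑ γ, D (τ.cyclePow 1 γ) = ∑ γ, D γ :=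
  (Function.Injective.bijective_of_finite (cyclePow_injective 1)).sum_comp D

/-- The question descends to `ℚ`, where `p` is positive and different from `1`. This is the
invertibility of the twisted difference in degrees `k ≠ lam`. -/
theorem zpow_pow_cycleLength_ne_one [CharZero K] (hp : 2 ≤ p) (hτ : τ.IsTorsion) {n : ℤ}
    (hn : n ≠ 0) : ((p : K) ^ n) ^ τ.cycleLength ≠ 1 := by
  rw [← zpow_natCast, ← zpow_mul]
  intro h
  have h1 : ((p : ℚ) ^ (n * τ.cycleLength)) = 1 := by
    have : (((p : ℚ) ^ (n * τ.cycleLength) : ℚ) : K) = ((1 : ℚ) : K) := by push_cast; exact h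
    exact_mod_cast this
  rw [zpow_eq_one_iff_right₀ (by positivity) (by norm_cast; omega)] at h1
  exact mul_ne_zero hn (Nat.cast_ne_zero.2 hτ) h1

/-! ### The cycle map degree by degree -/

theorem coe_cycle_ne_zero (γ : τ.cycle) : (γ : K) ≠ 0 := τ.ne_zero_of_mem γ.2.1

theorem zpow_mul_mahlerCoeff_self [CharZero K] [NeZero p] (lam : ℤ) (k : ℕ) (γ : τ.cycle) :
    (p : K) ^ lam * mahlerCoeff p k k 1 (γ : K) =
      (p : K) ^ (lam - k) * ((γ : K) ^ k * (((τ.cyclePow 1 γ : τ.cycle) : K) ^ k)⁻¹) := by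
  have hp0 : (p : K) ≠ 0 := Nat.cast_ne_zero.2 (NeZero.ne p)
  rw [mahlerCoeff_eq p k k 1 (coe_cycle_ne_zero γ), if_pos le_rfl, univCoeff_self,
    zpow_sub₀ hp0, zpow_sub₀ (coe_cycle_ne_zero γ), coe_cyclePow, ← pow_mul]
  rw [show ((k : ℤ) * (p : ℤ) ^ 1) = ((p ^ 1 * k : ℕ) : ℤ) by push_cast; ring]
  simp only [zpow_natCast, one_mul, div_eq_mul_inv]
  ring

theorem cycleMap_eq_of_bound (lam : ℤ) {d : τ.CycleSpace} {M : ℕ+}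
    (hM : ∀ γ s, M < s → d γ s = 0) (γ : τ.cycle) (k : ℕ+) :
    τ.cycleMap lam d γ k = -d γ k + (p : K) ^ lam * mahlerCoeff p k k 1 (γ : K) *
      d (τ.cyclePow 1 γ) k + (p : K) ^ lam * ∑ s ∈ Finset.Ioc k M,
        mahlerCoeff p s k 1 (γ : K) * d (τ.cyclePow 1 γ) s := by
  have h : ∑ s ∈ (d (τ.cyclePow 1 γ)).support with k ≤ s,
      mahlerCoeff p s k 1 (γ : K) * d (τ.cyclePow 1 γ) s =
      ∑ s ∈ insert k (Finset.Ioc k M), mahlerCoeff p s k 1 (γ : K) * d (τ.cyclePow 1 γ) s := by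
    refine Finset.sum_subset ?_ ?_
    · intro s hs
      rw [Finset.mem_filter, Finsupp.mem_support_iff] at hs
      rw [Finset.mem_insert, Finset.mem_Ioc]
      rcases hs.2.eq_or_lt with h | h
      · exact Or.inl h.symm
      · exact Or.inr ⟨h, not_lt.1 fun h1 => hs.1 (hM _ _ h1)⟩
    · intro s hs hs'
      have hks : k ≤ s := by
        rw [Finset.mem_insert, Finset.mem_Ioc] at hs
        rcases hs with h | h
        · exact h.ge
        · exact h.1.le
      rw [Finset.mem_filter, Finsupp.mem_support_iff] at hs'
      have : d (τ.cyclePow 1 γ) s = 0 := by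
        by_contra h
        exact hs' ⟨h, hks⟩
      rw [this, mul_zero]
  rw [cycleMap_apply, h, Finset.sum_insert (by simp)]
  ring

theorem eq_zero_of_topDegree_lt (d : τ.CycleSpace) : ∀ γ s, topDegree d < s → d γ s = 0 := by
  intro γ s hs
  by_contra h
  refine absurd hs (not_lt.2 ?_)
  have h1 : id s ≤ (d γ).support.sup id := Finset.le_sup (Finsupp.mem_support_iff.2 h)
  exact h1.trans (Finset.le_sup (f := fun γ => (d γ).support.sup id) (Finset.mem_univ γ))

/-- Downward induction on the degree, started above the finite top degree. The cutoff `k₀` allows it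
to stop just above the exceptional degree. -/
theorem cycleSpace_eq_zero_of_downward {d : τ.CycleSpace} {k₀ : ℤ}
    (h : ∀ k : ℕ+, k₀ ≤ k → (∀ γ s, k < s → d γ s = 0) → ∀ γ, d γ k = 0)
    {k : ℕ+} (hk : k₀ ≤ k) (γ : τ.cycle) : d γ k = 0 := by
  have key : ∀ n : ℕ, ∀ k : ℕ+, k₀ ≤ k → (topDegree d : ℕ) < k + n → ∀ γ, d γ k = 0 := by
    intro n
    induction n with
    | zero => exact fun k _ hk γ => eq_zero_of_topDegree_lt d γ k hk
    | succ n ih =>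
      intro k hk hn
      refine h k hk fun γ s hs => ih s ?_ ?_ γ
      · have : (k : ℕ) < s := hs
        omega
      · have : (k : ℕ) < s := hs
        omega
  exact key (topDegree d) k hk (by have := k.pos; omega) γ

/-- The leading entry of the cycle map, in normalized form. -/
theorem cycleMap_leading [CharZero K] [NeZero p] (lam : ℤ) {d : τ.CycleSpace} {k : ℕ+}
    (hk : ∀ γ s, k < s → d γ s = 0) (γ : τ.cycle) :
    τ.cycleMap lam d γ k = (γ : K) ^ (k : ℕ) *
      ((p : K) ^ (lam - k) * ((((τ.cyclePow 1 γ : τ.cycle) : K) ^ (k : ℕ))⁻¹ *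
        d (τ.cyclePow 1 γ) k) - (((γ : K) ^ (k : ℕ))⁻¹ * d γ k)) := by
  rw [cycleMap_eq_of_bound lam hk, Finset.Ioc_self, Finset.sum_empty, mul_zero, add_zero,
    zpow_mul_mahlerCoeff_self]
  have := coe_cycle_ne_zero γ
  field_simp
  ring

/-- After normalization by `γ ^ k`, the leading entry satisfies the homogeneous twisted equation,
which has only the zero solution when `k ≠ lam`. -/
theorem leading_eq_zero [CharZero K] [NeZero p] (hp : 2 ≤ p) (hτ : τ.IsTorsion) {lam : ℤ}
    {d : τ.CycleSpace} {k : ℕ+} (hkl : (k : ℤ) ≠ lam) (hk : ∀ γ s, k < s → d γ s = 0)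
    (h0 : ∀ γ, τ.cycleMap lam d γ k = 0) (γ : τ.cycle) : d γ k = 0 := by
  have hγ (δ : τ.cycle) : (δ : K) ^ (k : ℕ) ≠ 0 := pow_ne_zero _ (coe_cycle_ne_zero δ)
  have h := twisted_injective (D := fun δ => ((δ : K) ^ (k : ℕ))⁻¹ * d δ k)
    (zpow_pow_cycleLength_ne_one (K := K) hp hτ (n := lam - k) (by omega)) (fun δ => by
      have := h0 δ
      rw [cycleMap_leading lam hk] at this
      exact sub_eq_zero.1 ((mul_eq_zero.1 this).resolve_left (hγ δ))) γ
  exact (mul_eq_zero.1 h).resolve_left (inv_ne_zero (hγ γ))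

/-! ### The sections -/

theorem zeroSection_apply (lam : ℤ) (c : τ.CycleSpace) (γ : τ.cycle) (k : ℕ+) :
    τ.zeroSection lam c γ k = τ.zeroSectionCoeff lam c k γ := rfl

theorem zeroSection_eq_zero (lam : ℤ) (c : τ.CycleSpace) (γ : τ.cycle) (k : ℕ+)
    (hk : topDegree c < k) : τ.zeroSection lam c γ k = 0 := by
  rw [zeroSection_apply, zeroSectionCoeff, if_pos hk]

/-- The right-hand side of the recursion that defines the `0`-section. -/
def sectionRHS (lam : ℤ) (c : τ.CycleSpace) (k : ℕ+) (δ : τ.cycle) : K :=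
  c δ k - (p : K) ^ lam * ∑ s ∈ Finset.Ioc k (topDegree c),
    mahlerCoeff p s k 1 (δ : K) * τ.zeroSection lam c (τ.cyclePow 1 δ) s

/-- Puts the recursion into the shape of `twisted_solve` with `q = p ^ (lam - k)` and right-hand
side `γ ^ (-k) b_k(γ)`. -/
theorem zeroSection_of_ne {lam : ℤ} {c : τ.CycleSpace} {k : ℕ+} (hk : k ≤ topDegree c)
    (hkl : (k : ℤ) ≠ lam) (γ : τ.cycle) : τ.zeroSection lam c γ k =
      (γ : K) ^ (k : ℕ) * (1 / (((p : K) ^ (lam - k)) ^ τ.cycleLength - 1) *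
        ∑ j ∈ Finset.range τ.cycleLength, ((p : K) ^ (lam - k)) ^ j *
          (((τ.cyclePow j γ : τ.cycle) : K) ^ (k : ℕ))⁻¹ * sectionRHS lam c k (τ.cyclePow j γ)) := by
  rw [zeroSection_apply, zeroSectionCoeff, if_neg (not_lt.2 hk)]
  dsimp only
  rw [if_neg hkl, ← mul_assoc, mul_one_div, zpow_mul, zpow_natCast]
  refine congrArg _ (Finset.sum_congr rfl fun j _ => ?_)
  rw [sectionRHS, zpow_mul, zpow_natCast, coe_cyclePow, ← pow_mul, mul_comm (p ^ j)]
  congr 3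
  exact Finset.sum_attach (Finset.Ioc k (topDegree c)) fun s =>
    mahlerCoeff p s k 1 ((γ : K) ^ p ^ j) *
      τ.zeroSectionCoeff lam c s (τ.cyclePow 1 (τ.cyclePow j γ))

theorem zeroSection_of_eq {lam : ℤ} {c : τ.CycleSpace} {k : ℕ+} (hk : k ≤ topDegree c)
    (hkl : (k : ℤ) = lam) (γ : τ.cycle) : τ.zeroSection lam c γ k =
      (γ : K) ^ (k : ℕ) * (1 / (τ.cycleLength : K) *
        ∑ j ∈ Finset.range τ.cycleLength, ((j : K) + 1 - τ.cycleLength) *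
          (((τ.cyclePow j γ : τ.cycle) : K) ^ (k : ℕ))⁻¹ * sectionRHS lam c k (τ.cyclePow j γ)) := by
  rw [zeroSection_apply, zeroSectionCoeff, if_neg (not_lt.2 hk)]
  dsimp only
  rw [if_pos hkl, ← mul_assoc, mul_one_div]
  refine congrArg _ (Finset.sum_congr rfl fun j _ => ?_)
  rw [sectionRHS, coe_cyclePow, ← pow_mul, mul_comm (p ^ j)]
  congr 3
  exact Finset.sum_attach (Finset.Ioc k (topDegree c)) fun s =>
    mahlerCoeff p s k 1 ((γ : K) ^ p ^ j) *
      τ.zeroSectionCoeff lam c s (τ.cyclePow 1 (τ.cyclePow j γ))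

/-- The cycle map in degree `k` applied to a vector that solves the twisted difference equation. -/
theorem cycleMap_of_twisted [CharZero K] [NeZero p] {lam : ℤ} {d : τ.CycleSpace} {M : ℕ+}
    (hM : ∀ γ s, M < s → d γ s = 0) {k : ℕ+} {D B : τ.cycle → K}
    (hD : ∀ γ, d γ k = (γ : K) ^ (k : ℕ) * D γ) (γ : τ.cycle)
    (hB : (p : K) ^ (lam - k) * D (τ.cyclePow 1 γ) - D γ = B γ) :
    τ.cycleMap lam d γ k = (γ : K) ^ (k : ℕ) * B γ + (p : K) ^ lam * ∑ s ∈ Finset.Ioc k M,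
        mahlerCoeff p s k 1 (γ : K) * d (τ.cyclePow 1 γ) s := by
  rw [cycleMap_eq_of_bound lam hM, hD, hD, zpow_mul_mahlerCoeff_self, ← hB]
  have h1 := coe_cycle_ne_zero γ
  have h2 := coe_cycle_ne_zero (τ.cyclePow 1 γ)
  field_simp
  ring

theorem cycleMap_eq_zero_of_bound (lam : ℤ) {d : τ.CycleSpace} {M : ℕ+}
    (hM : ∀ γ s, M < s → d γ s = 0) (γ : τ.cycle) {k : ℕ+} (hk : M < k) :
    τ.cycleMap lam d γ k = 0 := by
  rw [cycleMap_eq_of_bound lam hM, hM _ _ hk, hM _ _ hk, Finset.Ioc_eq_empty (not_lt.2 hk.le)]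
  simp

theorem cycleMap_zeroSection_of_ne [CharZero K] [NeZero p] (hp : 2 ≤ p) (hτ : τ.IsTorsion)
    {lam : ℤ} (c : τ.CycleSpace) {k : ℕ+} (hkl : (k : ℤ) ≠ lam) (γ : τ.cycle) :
    τ.cycleMap lam (τ.zeroSection lam c) γ k = c γ k := by
  rcases lt_or_ge (topDegree c) k with hk | hk
  · rw [cycleMap_eq_zero_of_bound lam (zeroSection_eq_zero lam c) γ hk, eq_zero_of_topDegree_lt c γ k hk]
  rw [cycleMap_of_twisted (zeroSection_eq_zero lam c)
    (B := fun δ => ((δ : K) ^ (k : ℕ))⁻¹ * sectionRHS lam c k δ)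
    (fun δ => zeroSection_of_ne hk hkl δ) γ (by
      simpa only [mul_assoc] using twisted_solve
        (zpow_pow_cycleLength_ne_one (K := K) hp hτ (n := lam - k) (by omega))
        (fun δ => ((δ : K) ^ (k : ℕ))⁻¹ * sectionRHS lam c k δ) γ)]
  rw [mul_inv_cancel_left₀ (pow_ne_zero _ (coe_cycle_ne_zero γ)), sectionRHS, sub_add_cancel]

/-- In degree `lam` the twist is trivial, so the equation is solved up to a mean `A`, the same for
all `γ`. Thus `A` is the only obstruction to `c` lying in the image. -/
theorem cycleMap_zeroSection_of_eq [CharZero K] [NeZero p] (hτ : τ.IsTorsion)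
    {lam : ℤ} (c : τ.CycleSpace) {k : ℕ+} (hkl : (k : ℤ) = lam) :
    ∃ A : K, ∀ γ, τ.cycleMap lam (τ.zeroSection lam c) γ k = c γ k - (γ : K) ^ (k : ℕ) * A := by
  rcases lt_or_ge (topDegree c) k with hk | hk
  · refine ⟨0, fun γ => ?_⟩
    rw [cycleMap_eq_zero_of_bound lam (zeroSection_eq_zero lam c) γ hk, eq_zero_of_topDegree_lt c γ k hk,
      mul_zero, sub_zero]
  refine ⟨1 / (τ.cycleLength : K) * ∑ δ : τ.cycle,
    ((δ : K) ^ (k : ℕ))⁻¹ * sectionRHS lam c k δ, fun γ => ?_⟩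
  rw [cycleMap_of_twisted (zeroSection_eq_zero lam c)
    (B := fun δ => ((δ : K) ^ (k : ℕ))⁻¹ * sectionRHS lam c k δ - 1 / (τ.cycleLength : K) *
      ∑ δ : τ.cycle, ((δ : K) ^ (k : ℕ))⁻¹ * sectionRHS lam c k δ)
    (fun δ => zeroSection_of_eq hk hkl δ) γ (by
      rw [hkl, sub_self, zpow_zero, one_mul]
      simpa only [mul_assoc] using untwisted_solve hτ
        (fun δ => ((δ : K) ^ (k : ℕ))⁻¹ * sectionRHS lam c k δ) γ)]
  rw [mul_sub, mul_inv_cancel_left₀ (pow_ne_zero _ (coe_cycle_ne_zero γ)), sectionRHS]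
  ring

theorem kernelVec_apply (l : ℕ+) (γ : τ.cycle) (k : ℕ+) :
    τ.kernelVec l γ k = τ.kernelCoeff l k γ := rfl

theorem kernelVec_eq_zero (l : ℕ+) (γ : τ.cycle) (k : ℕ+) (hk : l < k) :
    τ.kernelVec l γ k = 0 := by
  rw [kernelVec_apply, kernelCoeff, if_pos hk]

theorem kernelVec_self (l : ℕ+) (γ : τ.cycle) : τ.kernelVec l γ l = (γ : K) ^ (l : ℕ) := by
  rw [kernelVec_apply, kernelCoeff, if_neg (lt_irrefl l), if_pos rfl]

/-- The recursion for `w` is again a solution of the twisted equation, with right-hand side chosen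
to cancel what the higher degrees contribute. -/
theorem kernelVec_of_lt [CharZero K] [NeZero p] {l k : ℕ+} (hk : k < l) (γ : τ.cycle) :
    τ.kernelVec l γ k = (γ : K) ^ (k : ℕ) *
      (1 / (((p : K) ^ ((l : ℤ) - k)) ^ τ.cycleLength - 1) *
        ∑ j ∈ Finset.range τ.cycleLength, ((p : K) ^ ((l : ℤ) - k)) ^ j *
          (((((τ.cyclePow j γ : τ.cycle) : K) ^ (k : ℕ))⁻¹) *
            -((p : K) ^ (l : ℤ) * ∑ s ∈ Finset.Ioc k l,
              mahlerCoeff p s k 1 ((τ.cyclePow j γ : τ.cycle) : K) *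
                τ.kernelVec l (τ.cyclePow 1 (τ.cyclePow j γ)) s))) := by
  rw [kernelVec_apply, kernelCoeff, if_neg (not_lt.2 hk.le), if_neg hk.ne]
  dsimp only
  rw [zpow_mul, zpow_natCast, ← neg_sub (_ ^ τ.cycleLength : K) 1, div_neg, mul_comm (_ ^ (l : ℕ)),
    mul_div_assoc, ← mul_neg, mul_assoc]
  congr 1
  rw [← neg_div, ← one_div_mul_eq_div, mul_assoc, neg_mul, Finset.mul_sum, ← Finset.sum_neg_distrib]
  congr 1
  refine Finset.sum_congr rfl fun j _ => ?_
  rw [Finset.sum_attach (Finset.Ioc k l) fun s => (p : K) ^ (((l : ℤ) - k) * j) *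
    (univCoeff p s k 1 : K) * ((γ : K) ^ ((s : ℕ) * p ^ (j + 1)))⁻¹ *
      τ.kernelCoeff l s (τ.cyclePow (j + 1) γ), mul_neg, mul_neg, zpow_natCast,
      mul_left_comm (_⁻¹), mul_left_comm (_ ^ j)]
  congr 2
  rw [Finset.mul_sum, Finset.mul_sum]
  refine Finset.sum_congr rfl fun s hs => ?_
  have hks : (k : ℕ) ≤ s := (Finset.mem_Ioc.1 hs).1.le
  have h0 := coe_cycle_ne_zero (τ.cyclePow j γ)
  rw [mahlerCoeff_eq p s k 1 h0, if_pos hks, cyclePow_cyclePow, add_comm 1 j, zpow_mul,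
    zpow_natCast, kernelVec_apply, zpow_sub₀ h0, pow_one, coe_cyclePow, pow_succ,
    show ((s : ℕ) : ℤ) * (p : ℤ) = ((p * s : ℕ) : ℤ) by push_cast; ring, zpow_natCast,
    zpow_natCast, ← mul_assoc (s : ℕ), mul_comm _ p, ← mul_assoc p, mul_comm (p * s) (p ^ j),
    pow_mul _ (p ^ j)]
  rw [coe_cyclePow] at h0
  field_simp

theorem cycleMap_kernelVec [CharZero K] [NeZero p] (hp : 2 ≤ p) (hτ : τ.IsTorsion) (l : ℕ+) :
    τ.cycleMap (l : ℤ) (τ.kernelVec l) = 0 := by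
  ext γ k
  rcases lt_trichotomy k l with hk | hk | hk
  · rw [cycleMap_of_twisted (kernelVec_eq_zero l)
      (B := fun δ => ((δ : K) ^ (k : ℕ))⁻¹ * -((p : K) ^ (l : ℤ) * ∑ s ∈ Finset.Ioc k l,
        mahlerCoeff p s k 1 (δ : K) * τ.kernelVec l (τ.cyclePow 1 δ) s))
      (fun δ => kernelVec_of_lt hk δ) γ (twisted_solve (zpow_pow_cycleLength_ne_one (K := K) hp hτ
        (n := l - k) (by have : (k : ℕ) < l := hk; omega))
          (fun δ => ((δ : K) ^ (k : ℕ))⁻¹ * -((p : K) ^ (l : ℤ) * ∑ s ∈ Finset.Ioc k l,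
            mahlerCoeff p s k 1 (δ : K) * τ.kernelVec l (τ.cyclePow 1 δ) s)) γ)]
    rw [mul_inv_cancel_left₀ (pow_ne_zero _ (coe_cycle_ne_zero γ)), neg_add_cancel]
    rfl
  · subst hk
    rw [cycleMap_of_twisted (kernelVec_eq_zero k) (D := fun _ => 1) (B := fun _ => 0)
      (fun δ => by rw [kernelVec_self, mul_one]) γ (by simp)]
    simp
  · exact cycleMap_eq_zero_of_bound _ (kernelVec_eq_zero l) γ hk

/-! ### Kernel and image of the cycle map -/

theorem cycleMap_injective [CharZero K] [NeZero p] (hp : 2 ≤ p) (hτ : τ.IsTorsion) {lam : ℤ}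
    (hlam : lam ≤ 0) {d : τ.CycleSpace} (h : τ.cycleMap lam d = 0) : d = 0 := by
  ext γ k
  refine cycleSpace_eq_zero_of_downward (k₀ := 0) (fun k _ hk => ?_) (by omega) γ
  refine leading_eq_zero hp hτ (lam := lam) (by have := k.pos; omega) hk fun γ => ?_
  rw [h]; rfl

/-- Entries above degree `l` vanish. In degree `l` the normalized entry `D` has constant difference
`A` along the cycle; summing around the cycle gives `e A = 0`, so `D` is a constant `ω`. Subtracting
`ω • w` leaves a kernel element that vanishes degree by degree. Admitting `A` in the hypothesis
covers a section whose image is known only up to its mean defect. -/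
theorem eq_smul_kernelVec [CharZero K] [NeZero p] (hp : 2 ≤ p) (hτ : τ.IsTorsion) (l : ℕ+)
    {d : τ.CycleSpace} {A : K} (hne : ∀ γ k, k ≠ l → τ.cycleMap l d γ k = 0)
    (hl : ∀ γ, τ.cycleMap l d γ l = (γ : K) ^ (l : ℕ) * A) :
    A = 0 ∧ ∃ ω : K, d = ω • τ.kernelVec l := by
  have habove (γ : τ.cycle) (k : ℕ+) (hk : l < k) : d γ k = 0 := by
    refine cycleSpace_eq_zero_of_downward (k₀ := (l : ℤ) + 1) (fun k hkl hk => ?_)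
      (by have : (l : ℕ) < k := hk; omega) γ
    exact leading_eq_zero hp hτ (lam := l) (by omega) hk
      fun γ => hne γ k (by rintro rfl; omega)
  set D : τ.cycle → K := fun δ => ((δ : K) ^ (l : ℕ))⁻¹ * d δ l with hD
  have hγ (δ : τ.cycle) : (δ : K) ^ (l : ℕ) ≠ 0 := pow_ne_zero _ (coe_cycle_ne_zero δ)
  have hdiff (γ : τ.cycle) : D (τ.cyclePow 1 γ) - D γ = A := by
    have := hl γ
    rw [cycleMap_leading _ habove, sub_self, zpow_zero, one_mul] at this
    exact mul_left_cancel₀ (hγ γ) this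
  have hA : A = 0 := by
    have h1 : ∑ γ, (D (τ.cyclePow 1 γ) - D γ) = ∑ _γ : τ.cycle, A :=
      Finset.sum_congr rfl fun γ _ => hdiff γ
    rw [Finset.sum_sub_distrib, sum_comp_cyclePow, sub_self, Finset.sum_const, Finset.card_univ,
      ← cycleLength_eq_card, nsmul_eq_mul] at h1
    exact (mul_eq_zero.1 h1.symm).resolve_left (Nat.cast_ne_zero.2 hτ)
  refine ⟨hA, ?_⟩
  obtain ⟨γ₀, hγ₀⟩ := hτ.nonempty_cycle
  refine ⟨D ⟨γ₀, hγ₀⟩, ?_⟩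
  have hconst (δ : τ.cycle) : D δ = D ⟨γ₀, hγ₀⟩ :=
    eq_of_cyclePow_invariant (fun γ => sub_eq_zero.1 (by rw [hdiff, hA])) _ _
  rw [← sub_eq_zero]
  set ω := D ⟨γ₀, hγ₀⟩
  have hker : τ.cycleMap l (d - ω • τ.kernelVec l) = 0 := by
    rw [map_sub, map_smul, cycleMap_kernelVec hp hτ, smul_zero, sub_zero]
    ext γ k
    by_cases hk : k = l
    · rw [hk, hl, hA, mul_zero]; rfl
    · rw [hne γ k hk]; rfl
  ext γ k
  refine cycleSpace_eq_zero_of_downward (k₀ := 0) (fun k _ hk => ?_) (by omega) γ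
  by_cases hkl : k = l
  · intro δ
    rw [hkl]
    change d δ l - ω * τ.kernelVec l δ l = 0
    rw [kernelVec_self, ← hconst δ, hD]
    have := hγ δ
    field_simp
    ring
  · refine leading_eq_zero hp hτ (lam := l) (fun h => hkl (by exact_mod_cast h)) hk fun γ => ?_
    rw [hker]; rfl

theorem omegaSection_natCast (l : ℕ+) (ω : K) (c : τ.CycleSpace) :
    τ.omegaSection (l : ℤ) ω c = τ.zeroSection l c + ω • τ.kernelVec l := by
  rw [omegaSection, dif_pos (by have := l.pos; omega)]
  rfl

theorem omegaSection_of_nonpos {lam : ℤ} (hlam : lam ≤ 0) (ω : K) (c : τ.CycleSpace) :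
    τ.omegaSection lam ω c = τ.zeroSection lam c := by
  rw [omegaSection, dif_neg (not_lt.2 hlam)]

theorem exists_pnat_of_pos {lam : ℤ} (hlam : 0 < lam) : ∃ l : ℕ+, (l : ℤ) = lam :=
  ⟨⟨lam.toNat, Int.lt_toNat.2 (by simpa using hlam)⟩, Int.toNat_of_nonneg hlam.le⟩

theorem cycleMap_omegaSection [CharZero K] [NeZero p] (hp : 2 ≤ p) (hτ : τ.IsTorsion) (lam : ℤ)
    (ω : K) (c : τ.CycleSpace) :
    τ.cycleMap lam (τ.omegaSection lam ω c) = τ.cycleMap lam (τ.zeroSection lam c) := by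
  rcases le_or_gt lam 0 with h | h
  · rw [omegaSection_of_nonpos h]
  · obtain ⟨l, rfl⟩ := exists_pnat_of_pos h
    rw [omegaSection_natCast, map_add, map_smul, cycleMap_kernelVec hp hτ, smul_zero, add_zero]

/-- If `c` is in the image of the cycle map, its preimages are the values of the sections. -/
theorem eq_omegaSection_of_cycleMap_eq [CharZero K] [NeZero p] (hp : 2 ≤ p) (hτ : τ.IsTorsion)
    {lam : ℤ} {c d : τ.CycleSpace} (h : τ.cycleMap lam d = c) :
    τ.cycleMap lam (τ.zeroSection lam c) = c ∧ ∃ ω, d = τ.omegaSection lam ω c := by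
  by_cases hlam : 0 < lam
  · obtain ⟨l, rfl⟩ := exists_pnat_of_pos hlam
    obtain ⟨A, hA⟩ := cycleMap_zeroSection_of_eq hτ c (k := l) rfl
    -- The image of `d - I^(0)(c)` is the defect of the `0`-section, which lives in degree `l` only.
    obtain ⟨hA0, ω, hω⟩ := eq_smul_kernelVec hp hτ l (d := d - τ.zeroSection l c) (A := A)
      (fun γ k hk => by
        rw [map_sub, h]
        change c γ k - τ.cycleMap l (τ.zeroSection l c) γ k = 0
        rw [cycleMap_zeroSection_of_ne hp hτ c (by exact_mod_cast hk), sub_self])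
      (fun γ => by
        rw [map_sub, h]
        change c γ l - τ.cycleMap l (τ.zeroSection l c) γ l = _
        rw [hA]
        ring)
    refine ⟨?_, ω, ?_⟩
    · ext γ k
      by_cases hk : k = l
      · rw [hk, hA, hA0, mul_zero, sub_zero]
      · rw [cycleMap_zeroSection_of_ne hp hτ c (by exact_mod_cast hk)]
    · rw [omegaSection_natCast, ← sub_eq_iff_eq_add', hω]
  · have hI : τ.cycleMap lam (τ.zeroSection lam c) = c := by
      ext γ k
      exact cycleMap_zeroSection_of_ne hp hτ c (by have := k.pos; omega) γ
    refine ⟨hI, 0, ?_⟩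
    rw [omegaSection_of_nonpos (not_lt.1 hlam), ← sub_eq_zero]
    exact cycleMap_injective hp hτ (not_lt.1 hlam) (by rw [map_sub, h, hI, sub_self])

end MahlerTree

end

section

/-! ### The difference operator and its telescoping sums -/

section Delta

variable {K : Type*} [Field K] (p : ℕ) [NeZero p] (lam : ℤ)

/-- The operator `g ↦ p ^ lam * g(x ^ p) - g(x)`. -/
def delta : RatFunc K →ₗ[K] RatFunc K :=
  ((p : K) ^ lam) • (sigma p).toLinearMap - LinearMap.id

theorem delta_apply (g : RatFunc K) : delta p lam g = ((p : K) ^ lam) • sigma p g - g := rfl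

theorem isMahlerSummable_iff (f : RatFunc K) :
    IsMahlerSummable p lam f ↔ ∃ g, f = delta p lam g := by
  simp only [IsMahlerSummable, mahlerOp_eq_sigma, delta_apply]

/-- The sum `∑ n < h, p ^ (lam * n) * f(x ^ (p ^ n))`. -/
def orbitSum (h : ℕ) (f : RatFunc K) : RatFunc K :=
  ∑ n ∈ Finset.range h, ((p : K) ^ lam) ^ n • sigma (p ^ n) f

theorem sigma_pow_succ (n : ℕ) (f : RatFunc K) :
    sigma (p ^ n) (sigma p f) = sigma (p ^ (n + 1)) f := by
  rw [← sigma_pow_one p f, sigma_sigma]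

theorem sigma_pow_succ' (n : ℕ) (f : RatFunc K) :
    sigma p (sigma (p ^ n) f) = sigma (p ^ (n + 1)) f := by
  rw [← sigma_pow_one p (sigma (p ^ n) f), sigma_sigma]
  simp only [add_comm]

theorem sigma_delta (n : ℕ) (g : RatFunc K) :
    delta p lam (sigma (p ^ n) g) = sigma (p ^ n) (delta p lam g) := by
  rw [delta_apply, delta_apply, map_sub, map_smul, sigma_pow_succ, sigma_pow_succ']

/-- The summands are the consecutive differences of `P ^ n • σ ^ n g`, where `P = p ^ lam`. -/
theorem orbitSum_delta (h : ℕ) (g : RatFunc K) :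
    orbitSum p lam h (delta p lam g) = ((p : K) ^ lam) ^ h • sigma (p ^ h) g - g := by
  have h1 := Finset.sum_range_sub (fun n => ((p : K) ^ lam) ^ n • sigma (p ^ n) g) h
  rw [sigma_pow_zero, pow_zero, one_smul] at h1
  rw [← h1, orbitSum]
  refine Finset.sum_congr rfl fun n _ => ?_
  rw [delta_apply, map_sub, map_smul, sigma_pow_succ, smul_sub, smul_smul, pow_succ ((p : K) ^ lam)]

theorem delta_orbitSum (h : ℕ) (f : RatFunc K) :
    delta p lam (orbitSum p lam h f) = ((p : K) ^ lam) ^ h • sigma (p ^ h) f - f := by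
  rw [← orbitSum_delta, orbitSum, orbitSum, map_sum]
  simp only [map_smul, sigma_delta]

end Delta

/-! ### Linearity and locality of partial fraction coefficients -/

variable {K : Type*} [Field K]

theorem pfCoeff_sub (f g : RatFunc K) (α : K) (k : ℕ) :
    pfCoeff (f - g) α k = pfCoeff f α k - pfCoeff g α k := map_sub (pfLin α k) f g

theorem pfCoeff_smul (a : K) (f : RatFunc K) (α : K) (k : ℕ) :
    pfCoeff (a • f) α k = a * pfCoeff f α k := map_smul (pfLin α k) a f

theorem pfCoeff_zero (α : K) (k : ℕ) : pfCoeff (0 : RatFunc K) α k = 0 := map_zero (pfLin α k)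

theorem pfCoeff_sum {ι : Type*} (s : Finset ι) (f : ι → RatFunc K) (α : K) (k : ℕ) :
    pfCoeff (∑ i ∈ s, f i) α k = ∑ i ∈ s, pfCoeff (f i) α k := map_sum (pfLin α k) f s

theorem pfCoeff_delta_congr [CharZero K] (p : ℕ) [NeZero p] (lam : ℤ) {f g : RatFunc K} {α : K}
    (h0 : ∀ s, 1 ≤ s → pfCoeff f α s = pfCoeff g α s)
    (h1 : ∀ s, 1 ≤ s → pfCoeff f (α ^ p) s = pfCoeff g (α ^ p) s) {k : ℕ} (hk : 1 ≤ k) :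
    pfCoeff (delta p lam f) α k = pfCoeff (delta p lam g) α k := by
  rw [delta_apply, delta_apply, pfCoeff_sub, pfCoeff_sub, pfCoeff_smul, pfCoeff_smul, h0 k hk,
    ← sigma_pow_one p f, ← sigma_pow_one p g, pfCoeff_sigma_congr p 1 (by rwa [pow_one]) hk]

theorem pfCoeff_orbitSum_congr [CharZero K] (p : ℕ) [NeZero p] (lam : ℤ) (h : ℕ) {f g : RatFunc K}
    {α : K} (hfg : ∀ n s, 1 ≤ s → pfCoeff f (α ^ p ^ n) s = pfCoeff g (α ^ p ^ n) s) {k : ℕ}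
    (hk : 1 ≤ k) : pfCoeff (orbitSum p lam h f) α k = pfCoeff (orbitSum p lam h g) α k := by
  rw [orbitSum, orbitSum, pfCoeff_sum, pfCoeff_sum]
  refine Finset.sum_congr rfl fun n _ => ?_
  rw [pfCoeff_smul, pfCoeff_smul, pfCoeff_sigma_congr p n (hfg n) hk]

theorem isProper_delta (p : ℕ) [NeZero p] (lam : ℤ) {g : RatFunc K} (hg : IsProper g) :
    IsProper (delta p lam g) :=
  ((hg.sigma p).smul _).sub hg

/-- Homogeneity of `f(x ^ (p ^ n))` under multiplication by `p ^ n`-th roots of unity. -/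
theorem pfCoeff_sigma_of_pow_eq [CharZero K] (p n : ℕ) [NeZero p] (g : RatFunc K) {β γ : K}
    (hβ : β ≠ 0) (hγ : γ ≠ 0) (h : β ^ p ^ n = γ ^ p ^ n) {k : ℕ} (hk : 1 ≤ k) :
    pfCoeff (sigma (p ^ n) g) β k = β ^ k * (γ ^ k)⁻¹ * pfCoeff (sigma (p ^ n) g) γ k := by
  have hM (s : ℕ) (hs : poleOrder g (γ ^ p ^ n) < s) : pfCoeff g (γ ^ p ^ n) s = 0 :=
    pfCoeff_eq_zero_of_lt hs
  rw [pfCoeff_sigma p n hβ (by rwa [h]) hk, pfCoeff_sigma p n hγ hM hk, Finset.mul_sum, h]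
  refine Finset.sum_congr rfl fun s hs => ?_
  have hks := (Finset.mem_Icc.1 hs).1
  rw [mahlerCoeff_eq p s k n hβ, mahlerCoeff_eq p s k n hγ, if_pos hks, if_pos hks,
    zpow_sub₀ hβ, zpow_sub₀ hγ,
    show (s : ℤ) * (p : ℤ) ^ n = ((p ^ n * s : ℕ) : ℤ) by push_cast; ring, zpow_natCast,
    zpow_natCast, zpow_natCast, zpow_natCast, pow_mul, pow_mul, h]
  field_simp

/-! ### The cycle map as the action of `delta` on principal parts -/

namespace MahlerTree

variable {p : ℕ} {τ : MahlerTree K p}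

theorem cycleCoeffs_apply (f : RatFunc K) (γ : τ.cycle) (k : ℕ+) :
    τ.cycleCoeffs f γ k = pfCoeff f (γ : K) k := rfl

theorem entry_coe (d : τ.CycleSpace) (γ : τ.cycle) (k : ℕ+) : d.entry k (γ : K) = d γ k := by
  rw [CycleSpace.entry, dif_pos ⟨γ.2, k.pos⟩]
  rfl

theorem entry_of_mem (d : τ.CycleSpace) {γ : K} (hγ : γ ∈ τ.cycle) {k : ℕ} (hk : 1 ≤ k) :
    d.entry k γ = d ⟨γ, hγ⟩ ⟨k, hk⟩ := by
  rw [CycleSpace.entry, dif_pos ⟨hγ, hk⟩]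

/-- The rational function with principal parts `d` at the points of the cycle. -/
def cycleFun (d : τ.CycleSpace) : RatFunc K :=
  ∑ γ : τ.cycle, ∑ k ∈ (d γ).support,
    RatFunc.C (d γ k) / (RatFunc.X - RatFunc.C (γ : K)) ^ (k : ℕ)

theorem pfCoeff_cycleFun (d : τ.CycleSpace) (β : K) {k : ℕ} (hk : 1 ≤ k) :
    pfCoeff (cycleFun d) β k = d.entry k β := by
  rw [cycleFun, pfCoeff_sum]
  simp only [pfCoeff_sum, pfCoeff_C_div_pow _ _ _ _ _ hk]
  by_cases hβ : β ∈ τ.cycle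
  · rw [Finset.sum_eq_single ⟨β, hβ⟩, entry_of_mem d hβ hk]
    · simp only [true_and]
      rw [Finset.sum_eq_single ⟨k, hk⟩]
      · simp
      · intro s _ hs
        rw [if_neg]
        rintro rfl
        exact hs rfl
      · intro h
        rw [Finsupp.notMem_support_iff.1 h, ite_self]
    · intro γ _ hγ
      refine Finset.sum_eq_zero fun s _ => if_neg ?_
      rintro ⟨rfl, -⟩
      exact hγ rfl
    · simp
  · rw [CycleSpace.entry, dif_neg (fun h => hβ h.1)]
    refine Finset.sum_eq_zero fun γ _ => Finset.sum_eq_zero fun s _ => if_neg ?_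
    rintro ⟨rfl, -⟩
    exact hβ γ.2

/-- The cycle is stable under `γ ↦ γ ^ p`, so `delta` acts on principal parts there without
reference to other points. The work is in matching the two index ranges. -/
theorem pfCoeff_delta_eq_cycleMap [CharZero K] [NeZero p] (lam : ℤ) {g : RatFunc K}
    {d : τ.CycleSpace} (hg : ∀ γ : τ.cycle, ∀ k : ℕ+, pfCoeff g (γ : K) k = d γ k) (γ : τ.cycle)
    (k : ℕ+) : pfCoeff (delta p lam g) (γ : K) k = τ.cycleMap lam d γ k := by
  rw [delta_apply, pfCoeff_sub, pfCoeff_smul, hg, cycleMap_apply, ← sigma_pow_one,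
    pfCoeff_sigma p 1 (coe_cycle_ne_zero γ) (M := topDegree d) (fun s hs =>
      (hg (τ.cyclePow 1 γ) ⟨s, by omega⟩).trans (eq_zero_of_topDegree_lt d _ _ hs)) k.pos, sub_eq_neg_add]
  congr 2
  set T := {s ∈ (d (τ.cyclePow 1 γ)).support | k ≤ s} with hT
  trans ∑ s ∈ T.map ⟨PNat.val, PNat.coe_injective⟩,
    mahlerCoeff p s k 1 (γ : K) * pfCoeff g ((γ : K) ^ p ^ 1) s
  · symm
    refine Finset.sum_subset ?_ ?_
    · intro s hs
      obtain ⟨t, ht, rfl⟩ := Finset.mem_map.1 hs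
      rw [hT, Finset.mem_filter, Finsupp.mem_support_iff] at ht
      rw [Finset.mem_Icc]
      exact ⟨ht.2, not_lt.1 fun h => ht.1 (eq_zero_of_topDegree_lt d _ _ h)⟩
    · intro s hs hs'
      obtain ⟨t, rfl⟩ : ∃ t : ℕ+, (t : ℕ) = s :=
        ⟨⟨s, k.pos.trans_le (Finset.mem_Icc.1 hs).1⟩, rfl⟩
      have h2 : d (τ.cyclePow 1 γ) t = 0 := by
        by_contra h
        refine hs' (Finset.mem_map.2 ⟨t, ?_, rfl⟩)
        rw [hT, Finset.mem_filter, Finsupp.mem_support_iff]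
        exact ⟨h, (Finset.mem_Icc.1 hs).1⟩
      exact mul_eq_zero_of_right _ ((hg (τ.cyclePow 1 γ) t).trans h2)
  · rw [Finset.sum_map]
    exact Finset.sum_congr rfl fun s _ => congrArg _ (hg (τ.cyclePow 1 γ) s)

/-! ### Poles in the tree -/

theorem pow_mem_carrier_iff_mem [NeZero p] {α : K} : α ^ p ∈ τ.carrier ↔ α ∈ τ.carrier := by
  have := τ.pow_mem_carrier_iff (α := α) (n := 1)
  rwa [pow_one] at this

theorem pfCoeff_component (f : RatFunc K) (α : K) {k : ℕ} (hk : 1 ≤ k) :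
    pfCoeff (τ.component f) α k = if α ∈ τ.carrier then pfCoeff f α k else 0 := by
  rw [component_eq_restrictPoles, pfCoeff_restrictPoles _ _ _ hk]

theorem mem_sing {f : RatFunc K} {α : K} (hα : α ∈ τ.carrier) {k : ℕ} (hk : 1 ≤ k)
    (h : pfCoeff f α k ≠ 0) : α ∈ τ.sing f := by
  rw [sing, Finset.mem_filter]
  refine ⟨?_, hα⟩
  by_contra h1
  exact h (pfCoeff_eq_zero_of_regularAt (regularAt_of_notMem_roots h1) hk)

theorem pfCoeff_eq_zero_of_ht_lt {f : RatFunc K} {α : K} (hα : α ∈ τ.carrier)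
    (h : τ.ht f < τ.height α) {k : ℕ} (hk : 1 ≤ k) : pfCoeff f α k = 0 := by
  by_contra h1
  exact absurd h (not_lt.2 (Finset.le_sup (mem_sing hα hk h1)))

theorem pfCoeff_eq_zero_of_ord_lt {f : RatFunc K} {α : K} (hα : α ∈ τ.carrier) {k : ℕ}
    (h : τ.ord f < k) : pfCoeff f α k = 0 := by
  by_contra h1
  have h2 : poleOrder f α ≤ τ.ord f := Finset.le_sup (mem_sing hα (by omega) h1)
  exact h1 (pfCoeff_eq_zero_of_lt (by omega))

theorem poleOrder_pos_of_mem_sing {f : RatFunc K} {α : K} (hα : α ∈ τ.sing f) :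
    0 < poleOrder f α := by
  rw [sing, Finset.mem_filter, Multiset.mem_toFinset, Polynomial.mem_roots'] at hα
  exact poleOrder_pos_iff.2 hα.1.2

theorem mem_carrier_of_mem_sing {f : RatFunc K} {α : K} (hα : α ∈ τ.sing f) : α ∈ τ.carrier :=
  (Finset.mem_filter.1 hα).2

theorem one_le_ord {f : RatFunc K} (h : (τ.sing f).Nonempty) : 1 ≤ τ.ord f := by
  obtain ⟨α, hα⟩ := h
  exact (poleOrder_pos_of_mem_sing hα).trans_le (Finset.le_sup hα)

/-- If `p ^ lam * g(x ^ p) - g` has no poles in `τ` of height above `h`, then all poles of `g` in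
`τ` have height less than `h`. -/
theorem IsTorsion.pfCoeff_eq_zero_of_delta [IsAlgClosed K] [CharZero K] [NeZero p] (hp : 2 ≤ p)
    (hτ : τ.IsTorsion) {lam : ℤ} {g : RatFunc K} {h : ℕ}
    (hg : ∀ α ∈ τ.carrier, h < τ.height α → ∀ k, 1 ≤ k → pfCoeff (delta p lam g) α k = 0)
    {α : K} (hα : α ∈ τ.carrier) (hh : h ≤ τ.height α) {k : ℕ} (hk : 1 ≤ k) :
    pfCoeff g α k = 0 := by
  -- Downward induction on the height, started above all poles of `g`: at a higher root `β` of `α`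
  -- both `delta g` and `g` are regular, hence so is `σ g`, and therefore `g` is regular at `α`.
  have key : ∀ n : ℕ, ∀ α ∈ τ.carrier, h ≤ τ.height α → τ.ht g < τ.height α + n →
      ∀ k, 1 ≤ k → pfCoeff g α k = 0 := by
    intro n
    induction n with
    | zero => exact fun α hα _ hn k hk => pfCoeff_eq_zero_of_ht_lt hα hn hk
    | succ n ih =>
      intro α hα hh hn
      obtain ⟨β, hβ, rfl, hht⟩ := hτ.exists_root hp hα
      refine pfCoeff_eq_zero_of_sigma p (τ.ne_zero_of_mem hβ) fun k hk => ?_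
      have h1 := hg β hβ (by omega) k hk
      rw [delta_apply, pfCoeff_sub, pfCoeff_smul, ih β hβ (by omega) (by omega) k hk, sub_zero] at h1
      exact (mul_eq_zero.1 h1).resolve_left
        (zpow_ne_zero _ (Nat.cast_ne_zero.2 (NeZero.ne p)))
  exact key (τ.ht g + 1) α hα hh (by omega) k hk

/-! ### Summability of the component -/

/-- The obstruction to summing `f` with prescribed principal parts `d` on the cycle, at the
elements of height `h`. -/
def obstruction (lam : ℤ) (h : ℕ) [NeZero p] (f : RatFunc K) (d : τ.CycleSpace) (α : K) (k : ℕ) :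
    K :=
  pfCoeff (orbitSum p lam h f) α k -
    ((p : K) ^ lam) ^ h * pfCoeff (sigma (p ^ h) (cycleFun d)) α k

section

variable [IsAlgClosed K] [CharZero K] [NeZero p]

/-- If all poles of `f` in `τ` were on the cycle, then `g` would have no pole in `τ` at all, and
neither would `delta g`. -/
theorem IsTorsion.ht_pos_of_summable (hp : 2 ≤ p) (hτ : τ.IsTorsion) {lam : ℤ} {f : RatFunc K}
    (hf : (τ.sing f).Nonempty) (hs : IsMahlerSummable p lam (τ.component f)) : 0 < τ.ht f := by
  rw [isMahlerSummable_iff] at hs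
  obtain ⟨g, hg⟩ := hs
  by_contra h0
  have hg0 (α : K) (hα : α ∈ τ.carrier) (k : ℕ) (hk : 1 ≤ k) : pfCoeff g α k = 0 := by
    refine hτ.pfCoeff_eq_zero_of_delta hp (lam := lam) (h := 0) (fun β hβ hht k hk => ?_) hα
      (Nat.zero_le _) hk
    rw [← hg, pfCoeff_component _ _ hk, if_pos hβ]
    exact pfCoeff_eq_zero_of_ht_lt hβ (by omega) hk
  obtain ⟨α, hα⟩ := hf
  have hατ := mem_carrier_of_mem_sing hα
  have hpos := poleOrder_pos_of_mem_sing hα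
  have h1 : pfCoeff (delta p lam g) α (poleOrder f α) = pfCoeff (delta p lam 0) α _ :=
    pfCoeff_delta_congr p lam (fun s hs => by rw [hg0 α hατ s hs, pfCoeff_zero])
      (fun s hs => by
        rw [hg0 (α ^ p) (pow_mem_carrier_iff_mem.2 hατ) s hs,
          pfCoeff_zero]) hpos
  rw [← hg, pfCoeff_component _ _ hpos, if_pos hατ, map_zero, pfCoeff_zero] at h1
  exact pfCoeff_poleOrder_ne_zero hpos h1

theorem IsTorsion.exists_of_summable (hp : 2 ≤ p) (hτ : τ.IsTorsion) {lam : ℤ} {f : RatFunc K}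
    (hs : IsMahlerSummable p lam (τ.component f)) :
    ∃ d : τ.CycleSpace, τ.cycleMap lam d = τ.cycleCoeffs f ∧
      ∀ α ∈ τ.level (τ.ht f), ∀ k, 1 ≤ k → obstruction lam (τ.ht f) f d α k = 0 := by
  rw [isMahlerSummable_iff] at hs
  obtain ⟨g, hg⟩ := hs
  refine ⟨τ.cycleCoeffs g, ?_, ?_⟩
  · ext γ k
    rw [← pfCoeff_delta_eq_cycleMap (g := g) lam (fun _ _ => rfl), ← hg,
      pfCoeff_component _ _ k.pos, if_pos γ.2.1, cycleCoeffs_apply]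
  · rintro α ⟨hα, hht⟩ k hk
    have h1 : pfCoeff g α k = 0 :=
      hτ.pfCoeff_eq_zero_of_delta hp (lam := lam) (h := τ.ht f) (fun β hβ hht k hk => by
        rw [← hg, pfCoeff_component _ _ hk, if_pos hβ]
        exact pfCoeff_eq_zero_of_ht_lt hβ hht hk) hα hht.ge hk
    have h2 : pfCoeff (orbitSum p lam (τ.ht f) f) α k =
        pfCoeff (orbitSum p lam (τ.ht f) (delta p lam g)) α k :=
      pfCoeff_orbitSum_congr p lam _ (fun n s hs => by
        rw [← hg, pfCoeff_component _ _ hs, if_pos (τ.pow_mem_carrier_iff.2 hα)]) hk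
    have h3 : pfCoeff (sigma (p ^ τ.ht f) (cycleFun (τ.cycleCoeffs g))) α k =
        pfCoeff (sigma (p ^ τ.ht f) g) α k :=
      pfCoeff_sigma_congr p _ (fun s hs => by
        rw [pfCoeff_cycleFun _ _ hs, entry_of_mem _ ((hτ.height_le_iff hα).1 hht.le) hs]
        rfl) hk
    rw [obstruction, h2, h3, orbitSum_delta, pfCoeff_sub, pfCoeff_smul, h1, sub_zero, sub_self]

theorem IsTorsion.summable_of_exists (hτ : τ.IsTorsion) {lam : ℤ} {f : RatFunc K}
    (hpos : 0 < τ.ht f) {d : τ.CycleSpace} (hd : τ.cycleMap lam d = τ.cycleCoeffs f)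
    (hobs : ∀ α ∈ τ.level (τ.ht f), ∀ k, 1 ≤ k → obstruction lam (τ.ht f) f d α k = 0) :
    IsMahlerSummable p lam (τ.component f) := by
  rw [isMahlerSummable_iff]
  set h := τ.ht f with hh
  set P : K := (p : K) ^ lam with hP
  -- Solving the telescoped identity `orbitSum (delta g) = P ^ h • σ ^ h g - g` for `g`, with `σ ^ h
  -- g` replaced by its prescribed part.
  set H : RatFunc K := P ^ h • sigma (p ^ h) (cycleFun d) - orbitSum p lam h f with hH
  set S : Set K := {α | α ∈ τ.carrier ∧ τ.height α < h} with hS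
  have hgS (α : K) (k : ℕ) (hk : 1 ≤ k) :
      pfCoeff (restrictPoles S H) α k = if α ∈ S then pfCoeff H α k else 0 := by
    rw [pfCoeff_restrictPoles _ _ _ hk]
    congr
  refine ⟨restrictPoles S H, ?_⟩
  rw [← sub_eq_zero]
  refine eq_zero_of_isProper ((isProper_restrictPoles _ _).sub
    (isProper_delta p lam (isProper_restrictPoles _ _))) fun α k hk => ?_
  rw [pfCoeff_sub, sub_eq_zero, pfCoeff_component _ _ hk]
  have hzero (h1 : α ∉ S) (h2 : α ^ p ∉ S) :
      pfCoeff (delta p lam (restrictPoles S H)) α k = 0 := by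
    rw [pfCoeff_delta_congr p lam (g := 0) (fun s hs => by rw [hgS α s hs, if_neg h1, pfCoeff_zero])
      (fun s hs => by rw [hgS _ s hs, if_neg h2, pfCoeff_zero]) hk, map_zero, pfCoeff_zero]
  by_cases hα : α ∈ τ.carrier
  swap
  · rw [if_neg hα, hzero (fun h1 => hα h1.1) (fun h1 => hα (pow_mem_carrier_iff_mem.1 h1.1))]
  rw [if_pos hα]
  have hhp : τ.height (α ^ p) = τ.height α - 1 := by
    have := hτ.height_pow hα 1
    rwa [pow_one] at this
  rcases lt_or_ge h (τ.height α) with hlt | hle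
  · rw [pfCoeff_eq_zero_of_ht_lt hα hlt hk,
      hzero (fun h1 => by have := h1.2; omega) (fun h1 => by have := h1.2; omega)]
  have hdelta : delta p lam H = P ^ h • sigma (p ^ h) (delta p lam (cycleFun d) - f) + f := by
    rw [hH, map_sub, map_smul, sigma_delta, delta_orbitSum, map_sub, smul_sub]
    abel
  have hcyc : α ^ p ^ h ∈ τ.cycle := (hτ.height_le_iff hα).1 hle
  -- For heights `≤ h` the point `α ^ p ^ h` is on the cycle, where `delta (cycleFun d)` and `f`
  -- have the same principal part by `hd`.
  have h3 : pfCoeff (sigma (p ^ h) (delta p lam (cycleFun d) - f)) α k = 0 := by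
    rw [pfCoeff_sigma_congr p h (g := 0) (fun s hs => ?_) hk, map_zero, pfCoeff_zero]
    have h4 := pfCoeff_delta_eq_cycleMap (g := cycleFun d) lam (fun γ k => by
      rw [pfCoeff_cycleFun _ _ k.pos, entry_coe]) ⟨_, hcyc⟩ ⟨s, hs⟩
    rw [hd] at h4
    rw [pfCoeff_sub, pfCoeff_zero, sub_eq_zero]
    exact h4
  have h5 : pfCoeff (delta p lam H) α k = pfCoeff f α k := by
    rw [hdelta, ← pfLin_apply, map_add, map_smul, pfLin_apply, h3, smul_zero, zero_add, pfLin_apply]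
  rw [← h5]
  refine pfCoeff_delta_congr p lam (fun s hs => ?_) (fun s hs => ?_) hk
  · rw [hgS α s hs]
    split_ifs with h6
    · rfl
    -- Truncation discards something at height exactly `h`, and there the vanishing obstruction says
    -- that `H` is regular.
    · have h7 : τ.height α = h := by
        by_contra h7
        exact h6 ⟨hα, by omega⟩
      have := hobs α ⟨hα, h7⟩ s hs
      rw [obstruction] at this
      rw [hH, pfCoeff_sub, pfCoeff_smul, ← neg_sub, this, neg_zero]
  · rw [hgS _ s hs, if_pos ⟨pow_mem_carrier_iff_mem.2 hα, by omega⟩]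

end

end MahlerTree

end

/-! ### The obstruction in coordinates -/

section

namespace MahlerTree

variable {K : Type*} [Field K] {p : ℕ} {τ : MahlerTree K p}

theorem IsTorsion.pow_mem_cycle_of_level (hτ : τ.IsTorsion) {h : ℕ} {α : K}
    (hα : α ∈ τ.level h) : α ^ p ^ (h + τ.cycleLength - 1) ∈ τ.cycle :=
  (hτ.height_le_iff hα.1).1 (by have := hτ.one_le_cycleLength; have := hα.2; omega)

/-- The obstruction in terms of partial fraction coefficients. -/
theorem IsTorsion.obstruction_eq [CharZero K] [NeZero p] (hτ : τ.IsTorsion) {lam : ℤ} {h : ℕ} (hh : 1 ≤ h)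
    {f : RatFunc K} {d : τ.CycleSpace} {M : ℕ} (hf : ∀ β ∈ τ.carrier, ∀ s, M < s → pfCoeff f β s = 0)
    (hd : ∀ (γ : τ.cycle) (s : ℕ+), M < s → d γ s = 0) {α : K} (hα : α ∈ τ.level h) {k : ℕ}
    (hk : 1 ≤ k) :
    obstruction lam h f d α k =
      (∑ s ∈ Finset.Icc k M, ∑ n ∈ Finset.range h,
        (p : K) ^ (lam * n) * mahlerCoeff p s k n α * pfCoeff f (α ^ p ^ n) s) -
      (p : K) ^ (lam * ((h : ℤ) - 1)) * ∑ s ∈ Finset.Icc k M,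
        (univCoeff p s k (h - 1) : K) *
          α ^ ((k : ℤ) - (s : ℤ) * (p : ℤ) ^ (h + τ.cycleLength - 1)) *
          ((τ.cycleMap lam d).entry s (α ^ p ^ (h + τ.cycleLength - 1)) +
            d.entry s (α ^ p ^ (h + τ.cycleLength - 1))) := by
  have he := hτ.one_le_cycleLength
  have hα0 := τ.ne_zero_of_mem hα.1
  have hp0 : (p : K) ≠ 0 := Nat.cast_ne_zero.2 (NeZero.ne p)
  have hγ := hτ.pow_mem_cycle_of_level hα
  set γ := α ^ p ^ (h + τ.cycleLength - 1) with hγdef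
  set β := α ^ p ^ (h - 1) with hβdef
  have hγ0 : γ ≠ 0 := τ.ne_zero_of_mem hγ.1
  have hβ0 : β ≠ 0 := pow_ne_zero _ hα0
  -- `β` has height one, and `γ` is the point of the cycle with the same `p`-th power.
  have hβγ : β ^ p ^ 1 = γ ^ p ^ 1 := by
    rw [hβdef, hγdef, ← pow_mul, ← pow_mul, ← pow_add, ← pow_add, Nat.sub_add_cancel hh,
      Nat.sub_add_cancel (by omega), pow_add_cycleLength ((hτ.height_le_iff hα.1).1 hα.2.le)]
  have hγp : β ^ p ^ 1 ∈ τ.cycle := by rw [hβγ]; exact τ.pow_mem_cycle hγ 1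
  have hgM (s : ℕ) (hs : M < s) : pfCoeff (cycleFun d) (β ^ p ^ 1) s = 0 := by
    rw [pfCoeff_cycleFun _ _ (by omega), entry_of_mem _ hγp (by omega)]
    exact hd _ _ hs
  have hsM (s : ℕ) (hs : M < s) : pfCoeff (sigma p (cycleFun d)) β s = 0 := by
    rw [← sigma_pow_one p (cycleFun d), pfCoeff_sigma p 1 hβ0 hgM (by omega),
      Finset.Icc_eq_empty (by omega), Finset.sum_empty]
  rw [obstruction]
  congr 1
  · rw [orbitSum, pfCoeff_sum, Finset.sum_comm]
    refine Finset.sum_congr rfl fun n _ => ?_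
    rw [pfCoeff_smul, pfCoeff_sigma p n hα0 (hf _ (τ.pow_mem_carrier_iff.2 hα.1)) hk,
      Finset.mul_sum]
    refine Finset.sum_congr rfl fun s _ => ?_
    rw [zpow_mul, zpow_natCast, mul_assoc]
  · obtain ⟨h, rfl⟩ : ∃ h', h = h' + 1 := ⟨h - 1, by omega⟩
    rw [Nat.add_sub_cancel] at hβdef ⊢
    -- Splitting `σ ^ (h + 1)` as `σ ^ h ∘ σ` explains why the universal coefficients have index one
    -- less than the height.
    rw [← sigma_pow_succ, pfCoeff_sigma p h hα0 (by rw [← hβdef]; exact hsM) hk, ← hβdef,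
      Nat.cast_add, Nat.cast_one, add_sub_cancel_right, zpow_mul, zpow_natCast, pow_succ,
      mul_assoc, Finset.mul_sum]
    congr 1
    refine Finset.sum_congr rfl fun s hs => ?_
    have hks := (Finset.mem_Icc.1 hs).1
    have hs1 : 1 ≤ s := hk.trans hks
    have h1 := pfCoeff_delta_eq_cycleMap (g := cycleFun d) lam (fun γ k => by
      rw [pfCoeff_cycleFun _ _ k.pos, entry_coe]) ⟨γ, hγ⟩ ⟨s, hs1⟩
    have h2 : pfCoeff (delta p lam (cycleFun d)) γ s = (τ.cycleMap lam d).entry s γ :=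
      h1.trans (entry_of_mem _ hγ hs1).symm
    -- At `γ`, the sum of the cycle map entry and `d` is the coefficient of `p ^ lam • σ (cycleFun
    -- d)`; homogeneity carries it from `γ` to `β`.
    rw [← h2, delta_apply, pfCoeff_sub, pfCoeff_cycleFun _ _ hs1, sub_add_cancel, pfCoeff_smul,
      ← sigma_pow_one p (cycleFun d), pfCoeff_sigma_of_pow_eq p 1 _ hβ0 hγ0 hβγ hs1,
      mahlerCoeff_eq p s k h hα0, if_pos hks, zpow_sub₀ hα0, zpow_sub₀ hα0]
    have h3 : α ^ ((s : ℤ) * (p : ℤ) ^ h) = β ^ s := by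
      rw [hβdef, ← pow_mul, ← zpow_natCast]
      congr 1
      push_cast
      ring
    have h4 : α ^ ((s : ℤ) * (p : ℤ) ^ (h + 1 + τ.cycleLength - 1)) = γ ^ s := by
      rw [hγdef, ← pow_mul, ← zpow_natCast]
      congr 1
      push_cast
      ring
    rw [h3, h4]
    field_simp

/-! ### The residual average -/

theorem topDegree_cycleCoeffs_le {f : RatFunc K} (hf : 1 ≤ τ.ord f) :
    (topDegree (τ.cycleCoeffs f) : ℕ) ≤ τ.ord f := by
  have : topDegree (τ.cycleCoeffs f) ≤ ⟨τ.ord f, hf⟩ := by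
    refine Finset.sup_le fun γ _ => Finset.sup_le fun s hs => ?_
    by_contra h
    exact Finsupp.mem_support_iff.1 hs (pfCoeff_eq_zero_of_ord_lt γ.2.1 (not_le.1 h))
  exact this

theorem zeroSection_eq_zero_of_ord_lt (lam : ℤ) {f : RatFunc K} (hf : 1 ≤ τ.ord f)
    (γ : τ.cycle) (s : ℕ+) (hs : τ.ord f < s) :
    τ.zeroSection lam (τ.cycleCoeffs f) γ s = 0 :=
  zeroSection_eq_zero _ _ _ _ ((topDegree_cycleCoeffs_le hf).trans_lt hs)

/-- The sums over `lam ≤ s ≤ ord` are empty. Hence `ω • w`, of degree `lam`, never pushes the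
section used in `dres` beyond the order of `f`. -/
theorem residualAverage_of_ord_lt {lam : ℤ} {f : RatFunc K} (h : (τ.ord f : ℤ) < lam) :
    τ.residualAverage lam f = 0 := by
  rw [residualAverage]
  split_ifs
  · rfl
  · rw [Finset.Icc_eq_empty (by omega)]
    simp

theorem omegaSection_eq_zero_of_ord_lt (lam : ℤ) {f : RatFunc K} (hf : 1 ≤ τ.ord f)
    (γ : τ.cycle) (s : ℕ+) (hs : τ.ord f < s) :
    τ.omegaSection lam (τ.residualAverage lam f) (τ.cycleCoeffs f) γ s = 0 := by
  have h0 := zeroSection_eq_zero_of_ord_lt lam hf γ s hs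
  rcases le_or_gt lam 0 with hlam | hlam
  · rwa [omegaSection_of_nonpos hlam]
  · obtain ⟨l, rfl⟩ := exists_pnat_of_pos hlam
    rw [omegaSection_natCast]
    change τ.zeroSection l (τ.cycleCoeffs f) γ s + τ.residualAverage l f * τ.kernelVec l γ s = 0
    rw [h0, zero_add]
    rcases lt_or_ge (τ.ord f) l with h | h
    · rw [residualAverage_of_ord_lt (by exact_mod_cast h), zero_mul]
    · rw [kernelVec_eq_zero l γ s (show (l : ℕ) < s by omega), mul_zero]

theorem entry_add (c d : τ.CycleSpace) (k : ℕ) (β : K) :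
    (c + d).entry k β = c.entry k β + d.entry k β := by
  simp only [CycleSpace.entry]
  split_ifs
  · rfl
  · rw [add_zero]

theorem entry_smul (a : K) (d : τ.CycleSpace) (k : ℕ) (β : K) :
    (a • d).entry k β = a * d.entry k β := by
  simp only [CycleSpace.entry]
  split_ifs
  · rfl
  · rw [mul_zero]

theorem entry_eq_zero {d : τ.CycleSpace} {M : ℕ}
    (hd : ∀ (γ : τ.cycle) (s : ℕ+), M < s → d γ s = 0) {k : ℕ} (hk : M < k) (β : K) :
    d.entry k β = 0 := by
  rw [CycleSpace.entry]
  split_ifs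
  · exact hd _ _ hk
  · rfl

/-- If some preimage `I^{(0)}(c) + ω • w` of `c` has no obstruction, then `ω` is the residual
average. -/
theorem IsTorsion.eq_residualAverage [IsAlgClosed K] [CharZero K] [NeZero p] (hp : 2 ≤ p)
    (hτ : τ.IsTorsion) (l : ℕ+) {f : RatFunc K} (hf : 1 ≤ τ.ord f) (hh : 1 ≤ τ.ht f) {ω : K}
    (hobs : ∀ α ∈ τ.level (τ.ht f),
      obstruction l (τ.ht f) f (τ.omegaSection l ω (τ.cycleCoeffs f)) α l = 0) :
    ω = τ.residualAverage l f := by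
  set h := τ.ht f with hhdef
  set m := τ.ord f with hm
  set c := τ.cycleCoeffs f with hc
  set d := τ.zeroSection l c with hd
  set c' := τ.cycleMap (l : ℤ) d with hc'
  have he := hτ.one_le_cycleLength
  set e := τ.cycleLength with hedef
  have hp0 : (p : K) ≠ 0 := Nat.cast_ne_zero.2 (NeZero.ne p)
  have hd0 : ∀ (γ : τ.cycle) (s : ℕ+), m < s → d γ s = 0 :=
    zeroSection_eq_zero_of_ord_lt l hf
  have hc0 : ∀ (γ : τ.cycle) (s : ℕ+), m < s → c' γ s = 0 := fun γ s hs =>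
    cycleMap_eq_zero_of_bound l (M := ⟨m, hf⟩) hd0 γ hs
  have hf0 : ∀ β ∈ τ.carrier, ∀ s, m < s → pfCoeff f β s = 0 := fun β hβ s hs =>
    pfCoeff_eq_zero_of_ord_lt hβ hs
  -- Here `ω` is still arbitrary, so `ω • w` may reach degree `l` even if `l > m`.
  set M := max m l with hM
  have hω0 : ∀ (γ : τ.cycle) (s : ℕ+), M < s → τ.omegaSection l ω c γ s = 0 := by
    intro γ s hs
    rw [omegaSection_natCast]
    change d γ s + ω * τ.kernelVec l γ s = 0
    rw [hd0 γ s (by omega), kernelVec_eq_zero l γ s (show (l : ℕ) < s by omega), mul_zero,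
      add_zero]
  set A : K → K := fun α => ∑ s ∈ Finset.Icc (l : ℕ) m, ∑ n ∈ Finset.range h,
    (p : K) ^ ((l : ℕ) * n) * (univCoeff p s l n : K) * (α ^ (s * p ^ n))⁻¹ *
      pfCoeff f (α ^ (p ^ n)) s with hA
  set G : K → K := fun γ => (p : K) ^ ((l : ℕ) * (h - 1)) * ∑ s ∈ Finset.Icc (l : ℕ) m,
    (univCoeff p s l (h - 1) : K) * (γ ^ s)⁻¹ * (c'.entry s γ + d.entry s γ) with hG
  have hsub : Finset.Icc (l : ℕ) m ⊆ Finset.Icc (l : ℕ) M :=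
    Finset.Icc_subset_Icc le_rfl (le_max_left _ _)
  have hres : τ.residualAverage l f = 1 / (((p : K) ^ h - (p : K) ^ (h - 1)) * (e : K)) *
      (∑ᶠ α ∈ τ.level h, A α) - 1 / (e : K) * ∑ γ : τ.cycle, G γ := by
    rw [residualAverage, if_neg (by have := l.pos; omega)]
    rw [hG, ← Finset.mul_sum, ← mul_assoc, one_div_mul_eq_div (e : K)]
    rfl
  -- This is the degree `l` obstruction divided by `α ^ l`: the unknown `ω` appears with coefficient
  -- `1`, uniformly in `α`.
  have hAG (α : K) (hα : α ∈ τ.level h) : A α = G (α ^ p ^ (h + e - 1)) + ω := by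
    have hα0 := τ.ne_zero_of_mem hα.1
    have hγ := hτ.pow_mem_cycle_of_level hα
    have h1 := hobs α hα
    rw [hτ.obstruction_eq hh (M := M) (fun β hβ s hs => hf0 β hβ s (by omega)) hω0 hα l.pos,
      cycleMap_omegaSection hp hτ, ← hd, ← hc', ← hedef, sub_eq_zero] at h1
    set γ := α ^ p ^ (h + e - 1) with hγdef
    have hγ0 : γ ≠ 0 := τ.ne_zero_of_mem hγ.1
    have hA2 : α ^ (l : ℕ) * A α = ∑ s ∈ Finset.Icc (l : ℕ) M, ∑ n ∈ Finset.range h,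
        (p : K) ^ ((l : ℤ) * n) * mahlerCoeff p s l n α * pfCoeff f (α ^ p ^ n) s := by
      rw [hA, Finset.mul_sum]
      refine (Finset.sum_congr rfl fun s hs => ?_).trans (Finset.sum_subset hsub fun s hs hs' => ?_)
      · rw [Finset.mul_sum]
        refine Finset.sum_congr rfl fun n _ => ?_
        rw [mahlerCoeff_eq p s l n hα0, if_pos (Finset.mem_Icc.1 hs).1, zpow_sub₀ hα0,
          show (s : ℤ) * (p : ℤ) ^ n = ((s * p ^ n : ℕ) : ℤ) by push_cast; ring,
          show (l : ℤ) * (n : ℤ) = (((l : ℕ) * n : ℕ) : ℤ) by push_cast; ring, zpow_natCast,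
          zpow_natCast, zpow_natCast]
        field_simp
      · refine Finset.sum_eq_zero fun n _ => ?_
        rw [hf0 _ (τ.pow_mem_carrier_iff.2 hα.1) s (by
          rw [Finset.mem_Icc] at hs hs'; omega), mul_zero]
    have hterm (s : ℕ) : α ^ ((l : ℤ) - (s : ℤ) * (p : ℤ) ^ (h + e - 1)) =
        α ^ (l : ℕ) * (γ ^ s)⁻¹ := by
      rw [zpow_sub₀ hα0, hγdef, ← pow_mul, ← zpow_natCast α (_ * s), zpow_natCast, div_eq_mul_inv]
      congr 3
      push_cast
      ring
    have hG2 : α ^ (l : ℕ) * (G γ + ω) = (p : K) ^ ((l : ℤ) * ((h : ℤ) - 1)) *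
        ∑ s ∈ Finset.Icc (l : ℕ) M, (univCoeff p s l (h - 1) : K) *
          α ^ ((l : ℤ) - (s : ℤ) * (p : ℤ) ^ (h + e - 1)) *
          (c'.entry s γ + (τ.omegaSection l ω c).entry s γ) := by
      have hsplit : ∑ s ∈ Finset.Icc (l : ℕ) M, (univCoeff p s l (h - 1) : K) *
          α ^ ((l : ℤ) - (s : ℤ) * (p : ℤ) ^ (h + e - 1)) *
          (c'.entry s γ + (τ.omegaSection l ω c).entry s γ) =
          α ^ (l : ℕ) * (∑ s ∈ Finset.Icc (l : ℕ) m,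
            (univCoeff p s l (h - 1) : K) * (γ ^ s)⁻¹ * (c'.entry s γ + d.entry s γ)) +
          α ^ (l : ℕ) * (ω * ∑ s ∈ Finset.Icc (l : ℕ) M,
            (univCoeff p s l (h - 1) : K) * (γ ^ s)⁻¹ * (τ.kernelVec l).entry s γ) := by
        rw [Finset.sum_subset hsub (f := fun s => (univCoeff p s l (h - 1) : K) * (γ ^ s)⁻¹ *
          (c'.entry s γ + d.entry s γ)) (fun s hs hs' => by
            have hms : m < s := by rw [Finset.mem_Icc] at hs hs'; omega
            rw [entry_eq_zero hc0 hms, entry_eq_zero hd0 hms, add_zero, mul_zero]),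
          Finset.mul_sum, Finset.mul_sum, Finset.mul_sum, ← Finset.sum_add_distrib]
        refine Finset.sum_congr rfl fun s _ => ?_
        rw [omegaSection_natCast, entry_add, entry_smul, hterm]
        ring
      -- Only the top entry `γ ^ l` of `w` is seen by degrees `s ≥ l`; its factor `p ^ (-(h - 1) l)`
      -- cancels the prefactor of `G`.
      have hker : ∑ s ∈ Finset.Icc (l : ℕ) M,
          (univCoeff p s l (h - 1) : K) * (γ ^ s)⁻¹ * (τ.kernelVec l).entry s γ =
          ((p : K) ^ ((h - 1) * (l : ℕ)))⁻¹ := by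
        rw [Finset.sum_eq_single (l : ℕ)]
        · have := entry_coe (τ.kernelVec l) ⟨γ, hγ⟩ l
          rw [kernelVec_self] at this
          rw [this, univCoeff_self]
          field_simp
        · intro s hs hsl
          rw [entry_eq_zero (M := l) (fun γ s hs => kernelVec_eq_zero l γ s hs)
            (by rw [Finset.mem_Icc] at hs; omega), mul_zero]
        · intro hl
          exact absurd (Finset.mem_Icc.2 ⟨le_rfl, le_max_right _ _⟩) hl
      rw [hsplit, hker, show (l : ℤ) * ((h : ℤ) - 1) = (((l : ℕ) * (h - 1) : ℕ) : ℤ) by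
        push_cast [Nat.cast_sub hh]; ring, zpow_natCast, hG, mul_comm (h - 1)]
      field_simp
    exact mul_left_cancel₀ (pow_ne_zero (l : ℕ) hα0) (by rw [hA2, h1, hG2])
  -- Averaging over the level now isolates `ω`.
  have hsum : ∑ᶠ α ∈ τ.level h, A α = ((p : K) ^ h - (p : K) ^ (h - 1)) *
      ∑ γ : τ.cycle, (G γ + ω) := by
    rw [← hτ.finsum_level hh (fun γ => G γ + ω)]
    exact finsum_mem_congr rfl hAG
  have hden : (p : K) ^ h - (p : K) ^ (h - 1) ≠ 0 := by
    rw [sub_ne_zero]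
    exact_mod_cast (Nat.pow_lt_pow_right (by omega) (Nat.sub_lt hh one_pos)).ne'
  have hne : (e : K) ≠ 0 := Nat.cast_ne_zero.2 (by omega)
  rw [hres, hsum, Finset.sum_add_distrib, Finset.sum_const, Finset.card_univ,
    ← cycleLength_eq_card, ← hedef, nsmul_eq_mul]
  field_simp
  ring

/-! ### Residues as obstructions, and the equivalence -/

theorem IsTorsion.dres_of_height_eq [CharZero K] [NeZero p] (hτ : τ.IsTorsion) (lam : ℤ)
    {f : RatFunc K} (hf : (τ.sing f).Nonempty) (hh : 1 ≤ τ.ht f) {k : ℕ} (hk : 1 ≤ k)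
    (hkm : k ≤ τ.ord f) {α : τ.carrier} (hα : τ.height (α : K) = τ.ht f) :
    τ.dres lam f k α = obstruction lam (τ.ht f) f
      (τ.omegaSection lam (τ.residualAverage lam f) (τ.cycleCoeffs f)) α k := by
  rw [hτ.obstruction_eq hh (M := τ.ord f) (fun β hβ s hs => pfCoeff_eq_zero_of_ord_lt hβ hs)
    (omegaSection_eq_zero_of_ord_lt lam (one_le_ord hf)) ⟨α.2, hα⟩ hk, dres,
    if_neg (not_or.2 ⟨hf.ne_empty, not_lt.2 hkm⟩), if_neg (by omega), if_pos hα]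

theorem dres_of_mem_cycle (hτ : τ.IsTorsion) {l : ℕ+} {f : RatFunc K} (hf : (τ.sing f).Nonempty)
    (hh : 1 ≤ τ.ht f) (hkm : (l : ℕ) ≤ τ.ord f) (γ : τ.cycle) :
    τ.dres l f l ⟨γ, γ.2.1⟩ = τ.cycleCoeffs f γ l -
      τ.cycleMap l (τ.omegaSection l (τ.residualAverage l f) (τ.cycleCoeffs f)) γ l := by
  have h0 : τ.height (γ : K) = 0 := (hτ.height_eq_zero_iff γ.2.1).2 γ.2
  rw [dres, if_neg (not_or.2 ⟨hf.ne_empty, not_lt.2 hkm⟩), if_neg (by omega),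
    if_neg (by simp only [h0]; omega), if_pos ⟨rfl, γ.2⟩]
  exact congrArg₂ (· - ·) (entry_coe _ γ l) (entry_coe _ γ l)

theorem IsTorsion.dres_eq_zero [CharZero K] [NeZero p] (hτ : τ.IsTorsion) {lam : ℤ}
    {f : RatFunc K} (hf : (τ.sing f).Nonempty) (hh : 1 ≤ τ.ht f)
    (hc : τ.cycleMap lam (τ.omegaSection lam (τ.residualAverage lam f) (τ.cycleCoeffs f)) =
      τ.cycleCoeffs f)
    (hobs : ∀ α ∈ τ.level (τ.ht f), ∀ k, 1 ≤ k → obstruction lam (τ.ht f) f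
      (τ.omegaSection lam (τ.residualAverage lam f) (τ.cycleCoeffs f)) α k = 0)
    {k : ℕ} (hk : 1 ≤ k) : τ.dres lam f k = 0 := by
  funext α
  rw [Pi.zero_apply]
  rcases lt_or_ge (τ.ord f) k with hkm | hkm
  · rw [dres, if_pos (Or.inr hkm)]
  by_cases hα : τ.height (α : K) = τ.ht f
  · rw [hτ.dres_of_height_eq lam hf hh hk hkm hα]
    exact hobs α ⟨α.2, hα⟩ k hk
  by_cases hcyc : (k : ℤ) = lam ∧ (α : K) ∈ τ.cycle
  · obtain ⟨rfl, hαc⟩ := hcyc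
    have := dres_of_mem_cycle hτ (l := ⟨k, hk⟩) hf hh hkm ⟨α, hαc⟩
    refine this.trans ?_
    rw [sub_eq_zero]
    exact (congrArg (fun v : τ.CycleSpace => v ⟨α, hαc⟩ ⟨k, hk⟩) hc).symm
  · rw [dres, if_neg (not_or.2 ⟨hf.ne_empty, not_lt.2 hkm⟩), if_neg (by omega), if_neg hα,
      if_neg hcyc]

/-- Degrees other than `lam` hold automatically. In degree `lam` the residue on the cycle is the
defect, unless `lam` exceeds the order of `f`, in which case both sides vanish. -/
theorem IsTorsion.cycleMap_eq_of_dres_eq_zero [CharZero K] [NeZero p] (hp : 2 ≤ p)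
    (hτ : τ.IsTorsion) {lam : ℤ} {f : RatFunc K} (hf : (τ.sing f).Nonempty) (hh : 1 ≤ τ.ht f)
    (hres : ∀ k : ℕ, 1 ≤ k → τ.dres lam f k = 0) :
    τ.cycleMap lam (τ.omegaSection lam (τ.residualAverage lam f) (τ.cycleCoeffs f)) =
      τ.cycleCoeffs f := by
  ext γ k
  by_cases hkl : (k : ℤ) = lam
  · subst hkl
    rcases lt_or_ge (τ.ord f) k with hkm | hkm
    · have hm := one_le_ord hf
      rw [cycleMap_eq_zero_of_bound _ (M := ⟨τ.ord f, hm⟩)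
        (omegaSection_eq_zero_of_ord_lt _ hm) γ hkm]
      exact (pfCoeff_eq_zero_of_ord_lt γ.2.1 hkm).symm
    · have h1 := dres_of_mem_cycle hτ hf hh hkm γ
      rw [hres k k.pos] at h1
      exact (sub_eq_zero.1 h1.symm).symm
  · rw [cycleMap_omegaSection hp hτ, cycleMap_zeroSection_of_ne hp hτ _ hkl]

/-- If the height were zero, the residue at a pole, in degree equal to its order, would be a nonzero
leading coefficient. -/
theorem IsTorsion.ht_pos_of_dres_eq_zero (hτ : τ.IsTorsion) {lam : ℤ}
    {f : RatFunc K} (hf : (τ.sing f).Nonempty) (hres : ∀ k : ℕ, 1 ≤ k → τ.dres lam f k = 0) :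
    1 ≤ τ.ht f := by
  by_contra h0
  obtain ⟨α, hα⟩ := hf
  have hατ := mem_carrier_of_mem_sing hα
  have hpos := poleOrder_pos_of_mem_sing hα
  have hle : poleOrder f α ≤ τ.ord f := Finset.le_sup hα
  have hht : τ.height α ≤ τ.ht f := Finset.le_sup hα
  have hcyc : α ∈ τ.cycle := (hτ.height_eq_zero_iff hατ).1 (by omega)
  have h1 := congrFun (hres _ hpos) ⟨α, hατ⟩
  rw [dres, if_neg (not_or.2 ⟨Finset.ne_empty_of_mem hα, not_lt.2 hle⟩), if_pos (by omega),
    if_pos hcyc] at h1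
  exact pfCoeff_poleOrder_ne_zero hpos h1

theorem IsTorsion.summable_iff_dres_eq_zero [IsAlgClosed K] [CharZero K] [NeZero p] (hp : 2 ≤ p)
    (hτ : τ.IsTorsion) (lam : ℤ) (f : RatFunc K) :
    IsMahlerSummable p lam (τ.component f) ↔ ∀ k : ℕ, 1 ≤ k → τ.dres lam f k = 0 := by
  rcases (τ.sing f).eq_empty_or_nonempty with hf | hf
  · refine iff_of_true ?_ fun k _ => ?_
    · rw [isMahlerSummable_iff]
      exact ⟨0, by rw [map_zero, component, hf, Finset.sum_empty]⟩
    · funext α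
      rw [dres, if_pos (Or.inl hf), Pi.zero_apply]
  constructor
  · intro hs k hk
    have hh := hτ.ht_pos_of_summable hp hf hs
    obtain ⟨d, hd, hobs⟩ := hτ.exists_of_summable hp hs
    obtain ⟨hc, ω, rfl⟩ := eq_omegaSection_of_cycleMap_eq hp hτ hd
    -- For `lam ≤ 0` the section does not depend on `ω`; for `lam ≥ 1` the vanishing obstruction in
    -- degree `lam` determines it.
    have hω : τ.omegaSection lam ω (τ.cycleCoeffs f) =
        τ.omegaSection lam (τ.residualAverage lam f) (τ.cycleCoeffs f) := by
      rcases le_or_gt lam 0 with hlam | hlam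
      · rw [omegaSection_of_nonpos hlam, omegaSection_of_nonpos hlam]
      · obtain ⟨l, rfl⟩ := exists_pnat_of_pos hlam
        rw [← hτ.eq_residualAverage hp l (one_le_ord hf) hh fun α hα => hobs α hα l l.pos]
    rw [hω] at hd hobs
    exact hτ.dres_eq_zero hf hh hd hobs hk
  · intro hres
    have hh := hτ.ht_pos_of_dres_eq_zero hf hres
    refine hτ.summable_of_exists hh (hτ.cycleMap_eq_of_dres_eq_zero hp hf hh hres)
      fun α hα k hk => ?_
    rcases lt_or_ge (τ.ord f) k with hkm | hkm
    · rw [hτ.obstruction_eq hh (M := τ.ord f) (fun β hβ s hs => pfCoeff_eq_zero_of_ord_lt hβ hs)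
        (omegaSection_eq_zero_of_ord_lt lam (one_le_ord hf)) hα hk,
        Finset.Icc_eq_empty (by omega), Finset.sum_empty, Finset.sum_empty, mul_zero, sub_zero]
    · have h1 := hτ.dres_of_height_eq lam hf hh hk hkm (α := ⟨α, hα.1⟩) hα.2
      rw [← h1, hres k hk, Pi.zero_apply]

end MahlerTree

end

end Mahler

end

theorem proposition5p17 {K : Type*} [Field K] [IsAlgClosed K] [CharZero K]
    (p : ℕ) (hp : 2 ≤ p) (lam : ℤ) (f : RatFunc K)
    (τ : Mahler.MahlerTree K p) (hτ : τ.IsTorsion) :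
    Mahler.IsMahlerSummable p lam (τ.component f) ↔
      ∀ k : ℕ, 1 ≤ k → τ.dres lam f k = 0 := by
  have : NeZero p := ⟨by omega⟩
  exact hτ.summable_iff_dres_eq_zero hp lam f
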